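/- \textbf{Setting.} All manifolds are smooth, connected, Hausdorff and second countable. Let $(\mathcal M,g)$ be a semi-Riemannian manifold of any signature, $\mathcal H$ a manifold with $\dim\mathcal M=\dim\mathcal H+1$, $\Phi:\mathcal H\to\mathcal M$ a smooth embedding, and $\xi$ a smooth vector field on an open neighbourhood $\mathcal W$ of $\Phi(\mathcal H)$ that is nowhere tangent to $\Phi(\mathcal H)$ (a rigging). Put $\gamma=\Phi^\star g$, $\ell=\Phi^\star(g(\xi,\cdot))$, $\ell^{(2)}=\Phi^\star(g(\xi,\xi))$, and let $P^{ab}$, $n^a$, $n^{(2)}$ be defined by inverting the symmetric form $\mathcal A((W,a),(V,b))=\gamma(W,V)+a\,\ell(V)+b\,\ell(W)+ab\,\ell^{(2)}$ on $T\mathcal H\times\mathbb R$, i.e. $\mathcal A^\sharp((\alpha,a),(\beta,b))=P(\alpha,\beta)+a\,\beta(n)+b\,\alpha(n)+ab\,n^{(2)}$. Assume that $\{\mathcal H,\gamma,\ell,\ell^{(2)}\}$ is null metric hypersurface data, i.e. $\mathcal A$ is everywhere non-degenerate and $n^{(2)}=0$. Write $\operatorname{tr}_PT=P^{ab}T_{ab}$,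 $U=\tfrac12\mathcal L_n\gamma$, $F=\tfrac12 d\ell$, $s=F(n,\cdot)$, and let $\mathring\nabla$ be the unique torsion-free connection on $\mathcal H$ with $\mathring\nabla_a\gamma_{bc}=-\ell_cU_{ab}-\ell_bU_{ac}$ and $\mathring\nabla_a\ell_b=F_{ab}-\ell^{(2)}U_{ab}$. Round brackets on indices denote symmetrization with weight $\tfrac12$. For $m\ge1$ let $$Y^{(m)}=\tfrac12\Phi^\star(\mathcal L_\xi^{(m)}g),\quad r^{(m)}=Y^{(m)}(n,\cdot),\quad \kappa^{(m)}=-Y^{(m)}(n,n),\quad Y=Y^{(1)},\ r=r^{(1)},\ \kappa_n=\kappa^{(1)},$$ $$\mathcal R^{(m)}=\Phi^\star(\mathcal L_\xi^{(m-1)}\mathrm{Ric}),\quad \dot{\mathcal R}^{(m)}=\Phi^\star\big((\mathcal L_\xi^{(m-1)}\mathrm{Ric})(\xi,\cdot)\big),\quad \ddot{\mathcal R}^{(m)}=\Phi^\star\big((\mathcal L_\xi^{(m-1)}\mathrm{Ric})(\xi,\xi)\big),$$ where $\mathrm{Ric}$ is the Ricci tensor of $g$. The scalar $\mathcal O^{(m)}$,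 one-form $\mathcal O^{(m)}_a$ and symmetric tensor $\mathcal O^{(m)}_{ab}$ on $\mathcal H$ are defined, for $m\ge1$, by $$\ddot{\mathcal R}^{(m)}=-\operatorname{tr}_PY^{(m+1)}+\mathcal O^{(m)},\qquad \dot{\mathcal R}^{(m)}_a=r^{(m+1)}_a+\mathcal O^{(m)}_a,$$ $$\begin{aligned}\mathcal R^{(m+1)}_{ab}={}&-2\mathcal L_nY^{(m+1)}_{ab}-\big(2(m+1)\kappa_n+\operatorname{tr}_PU\big)Y^{(m+1)}_{ab}-(\operatorname{tr}_PY^{(m+1)})U_{ab}+4P^{cd}U_{c(a}Y^{(m+1)}_{b)d}\\&+4(s-r)_{(a}r^{(m+1)}_{b)}+2\mathring\nabla_{(a}r^{(m+1)}_{b)}-2\kappa^{(m+1)}Y_{ab}+\mathcal O^{(m)}_{ab}.\end{aligned}$$ \textbf{Proposition.} Assume in addition that $\nabla_\xi\xi=0$ on $\mathcal W$ ($\nabla$ the Levi-Civita connection of $g$) and that $\ell^{(2)}=0$ on $\mathcal H$. Let $z$ be a smooth nowhere vanishing function on $\mathcal W$ with $\xi(z)=0$, let $\xi'=z\xi$,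 and let $\mathcal O^{(m)}{}'$, $\mathcal O^{(m)}_a{}'$, $\mathcal O^{(m)}_{ab}{}'$ be the tensors obtained by the above construction with $\xi'$ in place of $\xi$ (all of $\gamma,\ell,\ell^{(2)},P,n,U,s,\mathring\nabla,Y^{(k)},\dots$ being those of $\xi'$). Then for every $m\ge1$, writing $z$ also for $z\circ\Phi$, $$\begin{aligned}\mathcal O^{(m)}{}'&=z^{m+1}\mathcal O^{(m)},\\ \mathcal O^{(m)}_a{}'&=z^m\mathcal O^{(m)}_a-(m-1)z^{m-1}\big(\operatorname{tr}_PY^{(m)}-\mathcal O^{(m-1)}\big)\mathring\nabla_az,\\ \mathcal O^{(m)}_{ab}{}'&=z^m\mathcal O^{(m)}_{ab}+2mz^{m-1}\mathcal O^{(m)}_{(a}\mathring\nabla_{b)}z-m(m-1)z^{m-2}\big(\operatorname{tr}_PY^{(m)}-\mathcal O^{(m-1)}\big)\mathring\nabla_az\,\mathring\nabla_bz,\end{aligned}$$ where for $m=1$ the terms with the factor $m-1$ (which contain the undefined $\mathcal O^{(0)}$) are absent. -/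

import Mathlib

open scoped Manifold ContDiff Bundle
open VectorField FiberBundle

noncomputable section

namespace HypersurfaceData

section LinearAlgebra

variable {V : Type*} [AddCommGroup V] [Module ℝ V] [FiniteDimensional ℝ V]

open Classical in
/-- The vector `v` with `B (v, ·) = φ`, for a nondegenerate bilinear form `B` on a
finite-dimensional space (`0` by convention if `B` is degenerate). -/
def raise (B : LinearMap.BilinForm ℝ V) (φ : Module.Dual ℝ V) : V :=
  if h : B.Nondegenerate then (B.toDual h).symm φ else 0

/-- The contraction `P^{ab} T_{ab}`, written in a basis `b` of `V` and its dual basis. For bilinear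
`P` and `T` it does not depend on the basis. -/
def contract (P : Module.Dual ℝ V → Module.Dual ℝ V → ℝ) (T : V → V → ℝ) : ℝ :=
  ∑ i, ∑ j, P ((Module.finBasis ℝ V).coord i) ((Module.finBasis ℝ V).coord j) *
    T (Module.finBasis ℝ V i) (Module.finBasis ℝ V j)

end LinearAlgebra

section Tensors

variable {E : Type*} [NormedAddCommGroup E] [NormedSpace ℝ E] [FiniteDimensional ℝ E]
  {N : Type*} [TopologicalSpace N] [ChartedSpace E N] [IsManifold 𝓘(ℝ, E) ∞ N]

instance instFiniteDimensionalTangent (x : N) :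
    FiniteDimensional ℝ (TangentSpace 𝓘(ℝ, E) x) :=
  inferInstanceAs (FiniteDimensional ℝ E)

variable (E N) in
/-- Vector fields (smoothness is imposed separately). -/
abbrev VField := Π x : N, TangentSpace 𝓘(ℝ, E) x

variable (E N) in
/-- Covariant one-tensors, given by their values (linearity and smoothness are consequences of the
constructions below, whenever the objects they start from are smooth). -/
abbrev Cov1 := Π x : N, TangentSpace 𝓘(ℝ, E) x → ℝ

variable (E N) in
/-- Covariant two-tensors, given by their values. -/
abbrev Cov2 := Π x : N, TangentSpace 𝓘(ℝ, E) x → TangentSpace 𝓘(ℝ, E) x → ℝ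

/-- A smooth vector field near `x` with value `v` at `x`. The formulas below in which it appears
are tensorial in it, so that they do not depend on the choice of the extension. -/
def ext {x : N} (v : TangentSpace 𝓘(ℝ, E) x) : VField E N :=
  FiberBundle.extend E v

/-- The directional derivative `X(f)`. -/
def dirDeriv (X : VField E N) (f : N → ℝ) (x : N) : ℝ :=
  mvfderiv 𝓘(ℝ, E) f x (X x)

/-- The Lie derivative of a covariant two-tensor,
`(L_X T)(V, W) = X(T(V, W)) - T([X, V], W) - T(V, [X, W])`. -/
def lieD (X : VField E N) (T : Cov2 E N) : Cov2 E N := fun x v w =>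
  dirDeriv X (fun y => T y (ext v y) (ext w y)) x
    - T x (mlieBracket 𝓘(ℝ, E) X (ext v) x) w
    - T x v (mlieBracket 𝓘(ℝ, E) X (ext w) x)

/-- The exterior derivative of a one-form,
`dθ(V, W) = V(θ(W)) - W(θ(V)) - θ([V, W])`. -/
def extD (θ : Cov1 E N) : Cov2 E N := fun x v w =>
  dirDeriv (ext v) (fun y => θ y (ext w y)) x
    - dirDeriv (ext w) (fun y => θ y (ext v y)) x
    - θ x (mlieBracket 𝓘(ℝ, E) (ext v) (ext w) x)

/-- The right-hand side of the Koszul formula of a (possibly degenerate) symmetric two-tensor `T`;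
in coordinates `½ (∂_a T_{bd} + ∂_b T_{ad} - ∂_d T_{ab})` for coordinate fields. -/
def koszul (T : Cov2 E N) (X Y Z : VField E N) (x : N) : ℝ :=
  (1 / 2) * (dirDeriv X (fun y => T y (Y y) (Z y)) x
    + dirDeriv Y (fun y => T y (X y) (Z y)) x
    - dirDeriv Z (fun y => T y (X y) (Y y)) x
    + T x (mlieBracket 𝓘(ℝ, E) X Y x) (Z x)
    - T x (mlieBracket 𝓘(ℝ, E) X Z x) (Y x)
    - T x (mlieBracket 𝓘(ℝ, E) Y Z x) (X x))

end Tensors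

section Ambient

variable {F : Type*} [NormedAddCommGroup F] [NormedSpace ℝ F] [FiniteDimensional ℝ F]
  {M : Type*} [TopologicalSpace M] [ChartedSpace F M] [IsManifold 𝓘(ℝ, F) ∞ M]

variable (F M) in
/-- A smooth semi-Riemannian metric of arbitrary signature. (On a connected manifold the signature
is automatically constant.) -/
structure SemiRiemannianMetric where
  inner (x : M) : TangentSpace 𝓘(ℝ, F) x →L[ℝ] TangentSpace 𝓘(ℝ, F) x →L[ℝ] ℝ
  symm (x : M) (v w : TangentSpace 𝓘(ℝ, F) x) : inner x v w = inner x w v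
  nondegenerate (x : M) : (inner x).toBilinForm.Nondegenerate
  contMDiff : ContMDiff 𝓘(ℝ, F) (𝓘(ℝ, F).prod 𝓘(ℝ, F →L[ℝ] F →L[ℝ] ℝ)) ∞
    (fun x => Bundle.TotalSpace.mk' (F →L[ℝ] F →L[ℝ] ℝ)
      (E := fun x : M => TangentSpace 𝓘(ℝ, F) x →L[ℝ] TangentSpace 𝓘(ℝ, F) x →L[ℝ] ℝ)
      x (inner x))

namespace SemiRiemannianMetric

variable (g : SemiRiemannianMetric F M)

/-- The metric as a covariant two-tensor. -/
def toCov2 : Cov2 F M := fun x v w => g.inner x v w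

/-- The Levi-Civita derivative `∇_X Y`: the vector field with
`g(∇_X Y, Z) = koszul g X Y Z` for all `Z`. -/
def nabla (X Y : VField F M) : VField F M := fun x =>
  ∑ i, koszul g.toCov2 X Y (ext (Module.finBasis ℝ (TangentSpace 𝓘(ℝ, F) x) i)) x •
    raise (g.inner x).toBilinForm ((Module.finBasis ℝ (TangentSpace 𝓘(ℝ, F) x)).coord i)

/-- The curvature `R(X, Y) Z = ∇_X ∇_Y Z - ∇_Y ∇_X Z - ∇_{[X, Y]} Z`. -/
def riemann (X Y Z : VField F M) : VField F M := fun x =>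
  g.nabla X (g.nabla Y Z) x - g.nabla Y (g.nabla X Z) x
    - g.nabla (mlieBracket 𝓘(ℝ, F) X Y) Z x

/-- The Ricci tensor, `Ric(v, w) = trace (u ↦ R(u, v) w)`. -/
def ricci : Cov2 F M := fun x v w =>
  ∑ i, (Module.finBasis ℝ (TangentSpace 𝓘(ℝ, F) x)).coord i
    (g.riemann (ext (Module.finBasis ℝ (TangentSpace 𝓘(ℝ, F) x) i)) (ext v) (ext w) x)

end SemiRiemannianMetric

end Ambient

section Abstract

variable {E : Type*} [NormedAddCommGroup E] [NormedSpace ℝ E] [FiniteDimensional ℝ E]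
  {H : Type*} [TopologicalSpace H] [ChartedSpace E H] [IsManifold 𝓘(ℝ, E) ∞ H]

variable (E H) in
/-- The fields `γ`, `ℓ`, `ℓ⁽²⁾` of metric hypersurface data; the conditions on them are in
`MetricData.IsNull`. -/
structure MetricData where
  gamma (p : H) : TangentSpace 𝓘(ℝ, E) p →L[ℝ] TangentSpace 𝓘(ℝ, E) p →L[ℝ] ℝ
  ell (p : H) : TangentSpace 𝓘(ℝ, E) p →L[ℝ] ℝ
  ell2 : H → ℝ

namespace MetricData

variable (D : MetricData E H)

/-- The bilinear form
`𝒜((W, a), (V, b)) = γ(W, V) + a ℓ(V) + b ℓ(W) + a b ℓ⁽²⁾` on `T_p H × ℝ`. -/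
def formA (p : H) : LinearMap.BilinForm ℝ (TangentSpace 𝓘(ℝ, E) p × ℝ) :=
  LinearMap.mk₂ ℝ
    (fun x y => D.gamma p x.1 y.1 + x.2 * D.ell p y.1 + y.2 * D.ell p x.1
      + x.2 * y.2 * D.ell2 p)
    (fun x x' y => by simp; ring)
    (fun c x y => by simp; ring)
    (fun x y y' => by simp; ring)
    (fun c x y => by simp; ring)

/-- `P(α, ·)` as a vector: the tangent part of `𝒜^♯((α, 0), ·)`. -/
def Psharp (p : H) (α : Module.Dual ℝ (TangentSpace 𝓘(ℝ, E) p)) : TangentSpace 𝓘(ℝ, E) p :=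
  (raise (D.formA p) (α ∘ₗ LinearMap.fst ℝ (TangentSpace 𝓘(ℝ, E) p) ℝ)).1

/-- The symmetric contravariant tensor `P`. -/
def P (p : H) (α β : Module.Dual ℝ (TangentSpace 𝓘(ℝ, E) p)) : ℝ := β (D.Psharp p α)

/-- The vector field `n`: the tangent part of `𝒜^♯((0, 1), ·)`. -/
def n : VField E H := fun p =>
  (raise (D.formA p) (LinearMap.snd ℝ (TangentSpace 𝓘(ℝ, E) p) ℝ)).1

/-- The scalar `n⁽²⁾ = 𝒜^♯((0, 1), (0, 1))`. -/
def n2 (p : H) : ℝ :=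
  (raise (D.formA p) (LinearMap.snd ℝ (TangentSpace 𝓘(ℝ, E) p) ℝ)).2

/-- `D` is null metric hypersurface data: `γ` is a smooth symmetric two-tensor, `ℓ` a smooth
one-form, `ℓ⁽²⁾` a smooth function, `𝒜` is nondegenerate at every point, and `n⁽²⁾ = 0`. -/
structure IsNull : Prop where
  symm : ∀ p (v w : TangentSpace 𝓘(ℝ, E) p), D.gamma p v w = D.gamma p w v
  smooth_gamma : ContMDiff 𝓘(ℝ, E) (𝓘(ℝ, E).prod 𝓘(ℝ, E →L[ℝ] E →L[ℝ] ℝ)) ∞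
    (fun p => Bundle.TotalSpace.mk' (E →L[ℝ] E →L[ℝ] ℝ)
      (E := fun p : H => TangentSpace 𝓘(ℝ, E) p →L[ℝ] TangentSpace 𝓘(ℝ, E) p →L[ℝ] ℝ)
      p (D.gamma p))
  smooth_ell : ContMDiff 𝓘(ℝ, E) (𝓘(ℝ, E).prod 𝓘(ℝ, E →L[ℝ] ℝ)) ∞
    (fun p => Bundle.TotalSpace.mk' (E →L[ℝ] ℝ)
      (E := fun p : H => TangentSpace 𝓘(ℝ, E) p →L[ℝ] ℝ) p (D.ell p))
  smooth_ell2 : ContMDiff 𝓘(ℝ, E) 𝓘(ℝ, ℝ) ∞ D.ell2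
  nondegenerate : ∀ p, (D.formA p).Nondegenerate
  n2_eq_zero : ∀ p, D.n2 p = 0

/-- The trace `tr_P T = P^{ab} T_{ab}`. -/
def trP (T : Cov2 E H) (p : H) : ℝ := contract (D.P p) (T p)

/-- `γ` as a covariant two-tensor. -/
def gammaCov : Cov2 E H := fun p v w => D.gamma p v w

/-- `U = ½ L_n γ`. -/
def U : Cov2 E H := fun p v w => (1 / 2) * lieD D.n D.gammaCov p v w

/-- `F = ½ dℓ`. -/
def F : Cov2 E H := fun p v w => (1 / 2) * extD (fun q u => D.ell q u) p v w

/-- `s = F(n, ·)`. -/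
def s : Cov1 E H := fun p v => D.F p (D.n p) v

/-- The metric connection `∇°` of the data, in coordinates
`Γ^c_{ab} = ½ P^{cd} (∂_a γ_{bd} + ∂_b γ_{ad} - ∂_d γ_{ab}) + n^c ∂_{(a} ℓ_{b)}`.
For null data it is the unique torsion-free connection with
`∇°_a γ_{bc} = - ℓ_c U_{ab} - ℓ_b U_{ac}` and `∇°_a ℓ_b = F_{ab} - ℓ⁽²⁾ U_{ab}`:
the latter two are equivalent to `γ(∇°_X Y, Z) = koszul γ X Y Z + U(X, Y) ℓ(Z)` and
`ℓ(∇°_X Y) = X(ℓ(Y)) - F(X, Y) + ℓ⁽²⁾ U(X, Y)`, and every vector `V` is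
`P(γ(V, ·), ·) + ℓ(V) n`, where `P(ℓ, ·) = - ℓ⁽²⁾ n`. -/
def nablaO (X Y : VField E H) : VField E H := fun p =>
  (∑ i, koszul D.gammaCov X Y (ext (Module.finBasis ℝ (TangentSpace 𝓘(ℝ, E) p) i)) p •
    D.Psharp p ((Module.finBasis ℝ (TangentSpace 𝓘(ℝ, E) p)).coord i))
  + (dirDeriv X (fun q => D.ell q (Y q)) p - D.F p (X p) (Y p)) • D.n p

/-- The covariant derivative of a one-form, `(v, w) ↦ (∇°_v θ)(w)`. -/
def nablaOForm (θ : Cov1 E H) : Cov2 E H := fun p v w =>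
  dirDeriv (ext v) (fun q => θ q (ext w q)) p - θ p (D.nablaO (ext v) (ext w) p)

end MetricData

end Abstract

section Embedded

variable {E : Type*} [NormedAddCommGroup E] [NormedSpace ℝ E] [FiniteDimensional ℝ E]
  {H : Type*} [TopologicalSpace H] [ChartedSpace E H] [IsManifold 𝓘(ℝ, E) ∞ H]
  {F : Type*} [NormedAddCommGroup F] [NormedSpace ℝ F] [FiniteDimensional ℝ F]
  {M : Type*} [TopologicalSpace M] [ChartedSpace F M] [IsManifold 𝓘(ℝ, F) ∞ M]

/-- The pullback `Φ^* T` of a covariant two-tensor. -/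
def pullback2 (Φ : H → M) (T : Cov2 F M) : Cov2 E H := fun p v w =>
  T (Φ p) (mfderiv 𝓘(ℝ, E) 𝓘(ℝ, F) Φ p v) (mfderiv 𝓘(ℝ, E) 𝓘(ℝ, F) Φ p w)

/-- The metric hypersurface data `(Φ, ξ)`-embedded in `(M, g)`:
`γ = Φ^* g`, `ℓ = Φ^* (g(ξ, ·))`, `ℓ⁽²⁾ = Φ^* (g(ξ, ξ))`. -/
def inducedData (g : SemiRiemannianMetric F M) (Φ : H → M) (ξ : VField F M) :
    MetricData E H where
  gamma p := (ContinuousLinearMap.precomp ℝ (mfderiv 𝓘(ℝ, E) 𝓘(ℝ, F) Φ p)).comp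
    ((g.inner (Φ p)).comp (mfderiv 𝓘(ℝ, E) 𝓘(ℝ, F) Φ p))
  ell p := (g.inner (Φ p) (ξ (Φ p))).comp (mfderiv 𝓘(ℝ, E) 𝓘(ℝ, F) Φ p)
  ell2 p := g.inner (Φ p) (ξ (Φ p)) (ξ (Φ p))

/-- `ξ`, defined and smooth on the open neighbourhood `W` of `Φ(H)`, is a rigging of the embedded
hypersurface `Φ(H)`, that is, everywhere transversal to it. -/
structure IsRigging (Φ : H → M) (W : Set M) (ξ : VField F M) : Prop where
  codim_one : Module.finrank ℝ F = Module.finrank ℝ E + 1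
  embedding : Manifold.IsSmoothEmbedding 𝓘(ℝ, E) 𝓘(ℝ, F) ∞ Φ
  isOpen : IsOpen W
  range_subset : Set.range Φ ⊆ W
  smooth : ContMDiffOn 𝓘(ℝ, F) (𝓘(ℝ, F).prod 𝓘(ℝ, F)) ∞
    (fun x => (⟨x, ξ x⟩ : TangentBundle 𝓘(ℝ, F) M)) W
  transversal : ∀ p, ξ (Φ p) ∉ Set.range (mfderiv 𝓘(ℝ, E) 𝓘(ℝ, F) Φ p)

variable (g : SemiRiemannianMetric F M) (Φ : H → M) (ξ : VField F M)

/-- `Y^(m) = ½ Φ^* (L_ξ^(m) g)`. -/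
def Yexp (m : ℕ) : Cov2 E H := fun p v w =>
  (1 / 2) * pullback2 Φ ((lieD ξ)^[m] g.toCov2) p v w

/-- `r^(m) = Y^(m)(n, ·)`. -/
def rexp (m : ℕ) : Cov1 E H := fun p v =>
  Yexp g Φ ξ m p ((inducedData (E := E) g Φ ξ).n p) v

/-- `κ^(m) = - Y^(m)(n, n)`; in particular `κ_n = κ^(1)`. -/
def kexp (E : Type*) [NormedAddCommGroup E] [NormedSpace ℝ E] [FiniteDimensional ℝ E]
    {H : Type*} [TopologicalSpace H] [ChartedSpace E H] [IsManifold 𝓘(ℝ, E) ∞ H]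
    (g : SemiRiemannianMetric F M) (Φ : H → M) (ξ : VField F M) (m : ℕ) (p : H) : ℝ :=
  - Yexp g Φ ξ m p ((inducedData (E := E) g Φ ξ).n p) ((inducedData (E := E) g Φ ξ).n p)

/-- `tr_P Y^(m)`. -/
def trY (E : Type*) [NormedAddCommGroup E] [NormedSpace ℝ E] [FiniteDimensional ℝ E]
    {H : Type*} [TopologicalSpace H] [ChartedSpace E H] [IsManifold 𝓘(ℝ, E) ∞ H]
    (g : SemiRiemannianMetric F M) (Φ : H → M) (ξ : VField F M) (m : ℕ) (p : H) : ℝ :=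
  (inducedData (E := E) g Φ ξ).trP (Yexp g Φ ξ m) p

/-- `R^(m) = Φ^* (L_ξ^(m-1) Ric)`, for `m ≥ 1`. -/
def Ric0 (m : ℕ) : Cov2 E H := pullback2 Φ ((lieD ξ)^[m - 1] g.ricci)

/-- `Ṙ^(m) = Φ^* (L_ξ^(m-1) Ric (ξ, ·))`, for `m ≥ 1`. -/
def Ric1 (m : ℕ) : Cov1 E H := fun p v =>
  (lieD ξ)^[m - 1] g.ricci (Φ p) (ξ (Φ p)) (mfderiv 𝓘(ℝ, E) 𝓘(ℝ, F) Φ p v)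

/-- `R̈^(m) = Φ^* (L_ξ^(m-1) Ric (ξ, ξ))`, for `m ≥ 1`. -/
def Ric2 (m : ℕ) (p : H) : ℝ :=
  (lieD ξ)^[m - 1] g.ricci (Φ p) (ξ (Φ p)) (ξ (Φ p))

/-- The scalar `O^(m)`, for `m ≥ 1`, defined by `R̈^(m) = - tr_P Y^(m+1) + O^(m)`. -/
def Oscalar (E : Type*) [NormedAddCommGroup E] [NormedSpace ℝ E] [FiniteDimensional ℝ E]
    {H : Type*} [TopologicalSpace H] [ChartedSpace E H] [IsManifold 𝓘(ℝ, E) ∞ H]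
    (g : SemiRiemannianMetric F M) (Φ : H → M) (ξ : VField F M) (m : ℕ) (p : H) : ℝ :=
  Ric2 g Φ ξ m p + trY E g Φ ξ (m + 1) p

/-- The one-form `O_a^(m)`, for `m ≥ 1`, defined by `Ṙ^(m)_a = r^(m+1)_a + O_a^(m)`. -/
def Oform (m : ℕ) : Cov1 E H := fun p v =>
  Ric1 g Φ ξ m p v - rexp g Φ ξ (m + 1) p v

/-- The part of `R^(m+1)_{ab}` that is linear in `Y^(m+1)`:
`- 2 L_n Y^(m+1)_{ab} - (2 (m+1) κ_n + tr_P U) Y^(m+1)_{ab} - (tr_P Y^(m+1)) U_{ab}`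
`+ 4 P^{cd} U_{c(a} Y^(m+1)_{b)d} + 4 (s - r)_{(a} r^(m+1)_{b)} + 2 ∇°_{(a} r^(m+1)_{b)}`
`- 2 κ^(m+1) Y_{ab}`. -/
def leadingPart (m : ℕ) : Cov2 E H := fun p v w =>
  let D : MetricData E H := inducedData g Φ ξ
  let Ym : Cov2 E H := Yexp g Φ ξ (m + 1)
  let rm : Cov1 E H := rexp g Φ ξ (m + 1)
  let sr : Cov1 E H := fun q u => D.s q u - rexp g Φ ξ 1 q u;
  (-2) * lieD D.n Ym p v w
  - (2 * ((m : ℝ) + 1) * kexp E g Φ ξ 1 p + D.trP D.U p) * Ym p v w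
  - trY E g Φ ξ (m + 1) p * D.U p v w
  + 4 * contract (D.P p)
      (fun x y => (1 / 2) * (D.U p x v * Ym p w y + D.U p x w * Ym p v y))
  + 4 * ((1 / 2) * (sr p v * rm p w + sr p w * rm p v))
  + 2 * ((1 / 2) * (D.nablaOForm rm p v w + D.nablaOForm rm p w v))
  - 2 * kexp E g Φ ξ (m + 1) p * Yexp g Φ ξ 1 p v w

/-- The symmetric tensor `O_{ab}^(m)`, for `m ≥ 1`, defined by
`R^(m+1)_{ab} = leadingPart_{ab} + O_{ab}^(m)`. -/
def Otensor (m : ℕ) : Cov2 E H := fun p v w =>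
  Ric0 g Φ ξ (m + 1) p v w - leadingPart g Φ ξ m p v w

end Embedded

end HypersurfaceData

end

open HypersurfaceData

/-! Write `i_ξ` for contraction with `ξ`. For a symmetric tensor `T` one has `L_{zξ} T = z L_ξ T +
dz ⊗ i_ξ T + i_ξ T ⊗ dz`. Since `ξ(z) = 0`, the form `dz` is invariant under `ξ` and annihilates it,
and `L_ξ` commutes with `i_ξ`. Iterating therefore gives a closed formula with three terms: `z^m
L_ξ^m T`, then `m z^(m-1)` times the symmetrized product of `dz` with `i_ξ L_ξ^(m-1) T`, then
`m(m-1) z^(m-2) (L_ξ^(m-2) T)(ξ, ξ) dz ⊗ dz`. This is `iterate_lieD_smul`, and it is applied twice.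

For `T = g` the corrections almost disappear. A geodesic field satisfies `(L_ξ g)(ξ, ·) = ½ d(g(ξ,
ξ))`, and this form is invariant under `ξ`, so the contractions with `ξ` of all higher derivatives
vanish. As `g(ξ, ξ) = 0` on the hypersurface, the first one vanishes on tangent vectors as well.
Hence `Y^(k)` just acquires the factor `z^k` for `k ≥ 2`, and only `Y^(1)` picks up a term in `dz`
and `ℓ` (`Yexp_smul`, `Yexp_one_smul`).

The hypersurface data are rescaled by `n' = z⁻¹ n`, `P' = P`, `U' = z⁻¹ U`, with explicit changes of
`s` and `∇°` (`IsRescaling`). In the part of the Ricci expansion that is linear in `Y^(m+1)` all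
terms with `dz(n)` or `ℓ` cancel, leaving the factor `z^m` and `m z^(m-1) (dz ⊗ r^(m+1) + r^(m+1) ⊗
dz)` (`leadingPart_smul`).

For `T = Ric` the three terms are `R`, `Ṙ` and `R̈` of successively lower order (`Ric0_smul`,
`Ric1_smul`, `Ric2_smul`). Subtracting the leading part turns `Ṙ^(m) - r^(m+1)` into the one-form
`O^(m)`, while `R̈^(m-1)` equals `-(tr_P Y^(m) - O^(m-1))`.

Much of the file supplies what this needs about the connection and curvature defined by explicit
formulas: tensoriality, smoothness, and symmetry of `Ric`. -/

noncomputable section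

namespace HypersurfaceData

open Filter Topology

/-! ### Smooth functions and vector fields near a point. -/

section Calculus

variable {E : Type*} [NormedAddCommGroup E] [NormedSpace ℝ E]
  {N : Type*} [TopologicalSpace N] [ChartedSpace E N]

/-- The function `f` is smooth on a neighbourhood of `x`. -/
def SmoothFun (E : Type*) [NormedAddCommGroup E] [NormedSpace ℝ E]
    {N : Type*} [TopologicalSpace N] [ChartedSpace E N] (f : N → ℝ) (x : N) : Prop :=
  ∀ᶠ y in 𝓝 x, ContMDiffAt 𝓘(ℝ, E) 𝓘(ℝ, ℝ) ∞ f y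

namespace SmoothFun

variable {f h : N → ℝ} {x : N}

/-- The reason for asking smoothness on a whole neighbourhood: identities proved at a point then
hold as germs and can be differentiated again. -/
theorem eventually (hf : SmoothFun E f x) : ∀ᶠ y in 𝓝 x, SmoothFun E f y :=
  eventually_eventually_nhds.2 hf

theorem contMDiffAt (hf : SmoothFun E f x) : ContMDiffAt 𝓘(ℝ, E) 𝓘(ℝ, ℝ) ∞ f x :=
  hf.self_of_nhds

theorem mdiff (hf : SmoothFun E f x) : MDifferentiableAt 𝓘(ℝ, E) 𝓘(ℝ, ℝ) f x :=
  hf.contMDiffAt.mdifferentiableAt (by simp)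

theorem congr (hf : SmoothFun E f x) (hfh : h =ᶠ[𝓝 x] f) : SmoothFun E h x := by
  filter_upwards [hf, hfh.eventually_nhds] with y hy hy'
  exact hy.congr_of_eventuallyEq hy'

theorem const (c : ℝ) : SmoothFun E (fun _ : N => c) x :=
  Eventually.of_forall fun _ => contMDiffAt_const

theorem add (hf : SmoothFun E f x) (hh : SmoothFun E h x) :
    SmoothFun E (fun y => f y + h y) x := by
  filter_upwards [hf, hh] with y hy hy' using hy.add hy'

theorem sub (hf : SmoothFun E f x) (hh : SmoothFun E h x) :
    SmoothFun E (fun y => f y - h y) x := by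
  filter_upwards [hf, hh] with y hy hy' using hy.sub hy'

theorem neg (hf : SmoothFun E f x) : SmoothFun E (fun y => - f y) x := by
  filter_upwards [hf] with y hy using hy.neg

theorem mul (hf : SmoothFun E f x) (hh : SmoothFun E h x) :
    SmoothFun E (fun y => f y * h y) x := by
  filter_upwards [hf, hh] with y hy hy' using hy.mul hy'

theorem pow (hf : SmoothFun E f x) (k : ℕ) : SmoothFun E (fun y => f y ^ k) x := by
  filter_upwards [hf] with y hy using hy.pow k

theorem inv (hf : SmoothFun E f x) (h0 : f x ≠ 0) : SmoothFun E (fun y => (f y)⁻¹) x := by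
  filter_upwards [hf, hf.contMDiffAt.continuousAt.eventually_ne h0] with y hy hy'
  exact hy.inv₀ hy'

theorem sum {ι : Type*} {s : Finset ι} {f : ι → N → ℝ} (hf : ∀ i ∈ s, SmoothFun E (f i) x) :
    SmoothFun E (fun y => ∑ i ∈ s, f i y) x := by
  classical
  induction s using Finset.induction_on with
  | empty => simpa using const 0
  | insert a s ha ih =>
    simp only [Finset.sum_insert ha]
    exact (hf a (by simp)).add (ih fun i hi => hf i (by simp [hi]))

theorem prod {ι : Type*} {s : Finset ι} {f : ι → N → ℝ} (hf : ∀ i ∈ s, SmoothFun E (f i) x) :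
    SmoothFun E (fun y => ∏ i ∈ s, f i y) x := by
  classical
  induction s using Finset.induction_on with
  | empty => simpa using const 1
  | insert a s ha ih =>
    simp only [Finset.prod_insert ha]
    exact (hf a (by simp)).mul (ih fun i hi => hf i (by simp [hi]))

end SmoothFun

theorem SmoothFun.det {ι : Type*} [Fintype ι] [DecidableEq ι] {x : N} {G : N → Matrix ι ι ℝ}
    (hG : ∀ i j, SmoothFun E (fun y => G y i j) x) : SmoothFun E (fun y => (G y).det) x := by
  simp only [Matrix.det_apply']
  exact SmoothFun.sum fun σ _ => (SmoothFun.const _).mul (SmoothFun.prod fun i _ => hG _ _)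

/-- Smoothness of the solution of a linear system with smooth coefficients. -/
theorem SmoothFun.of_linear_system {ι : Type*} [Fintype ι] [DecidableEq ι] {x : N}
    {G : N → Matrix ι ι ℝ} {u c : ι → N → ℝ}
    (hG : ∀ i j, SmoothFun E (fun y => G y i j) x) (hdet : (G x).det ≠ 0)
    (hc : ∀ j, SmoothFun E (c j) x)
    (h : ∀ᶠ y in 𝓝 x, ∀ j, ∑ i, u i y * G y i j = c j y) (i : ι) :
    SmoothFun E (u i) x := by
  have hD := SmoothFun.det hG
  have hadj : SmoothFun E (fun y => ∑ j, c j y * (G y).adjugate j i) x := by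
    refine SmoothFun.sum fun j _ => (hc j).mul ?_
    simp only [Matrix.adjugate_apply]
    refine SmoothFun.det fun k l => ?_
    -- The adjugate entry is the determinant of `G` with row `i` replaced by a constant unit vector.
    by_cases hk : k = i
    · subst hk
      simpa using SmoothFun.const _
    · simpa [Matrix.updateRow_ne hk] using hG k l
  refine ((hD.inv hdet).mul hadj).congr ?_
  filter_upwards [h, hD.contMDiffAt.continuousAt.eventually_ne hdet] with y hy hy0
  have hvec : Matrix.vecMul (fun i => u i y) (G y) = fun j => c j y := by
    ext j
    simpa [Matrix.vecMul, dotProduct] using hy j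
  -- Cramer's rule, from `u G adj(G) = det(G) u`.
  have key : (G y).det * u i y = ∑ j, c j y * (G y).adjugate j i := by
    have h1 : Matrix.vecMul (Matrix.vecMul (fun i => u i y) (G y)) (G y).adjugate i
        = (G y).det * u i y := by
      rw [Matrix.vecMul_vecMul, Matrix.mul_adjugate, Matrix.vecMul_smul]
      simp
    rw [← h1, hvec]
    simp [Matrix.vecMul, dotProduct]
  rw [← key, inv_mul_cancel_left₀ hy0]

variable [IsManifold 𝓘(ℝ, E) ∞ N]

/-- The vector field `X` is smooth on a neighbourhood of `x`. -/
def SmoothField (X : VField E N) (x : N) : Prop :=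
  ∀ᶠ y in 𝓝 x, ContMDiffAt 𝓘(ℝ, E) (𝓘(ℝ, E).prod 𝓘(ℝ, E)) ∞
    (fun y => (⟨y, X y⟩ : TangentBundle 𝓘(ℝ, E) N)) y

namespace SmoothField

variable {X Y : VField E N} {f : N → ℝ} {x : N}

theorem eventually (hX : SmoothField X x) :
    ∀ᶠ y in 𝓝 x, SmoothField X y :=
  eventually_eventually_nhds.2 hX

theorem contMDiffAt (hX : SmoothField X x) :
    ContMDiffAt 𝓘(ℝ, E) (𝓘(ℝ, E).prod 𝓘(ℝ, E)) ∞
      (fun y => (⟨y, X y⟩ : TangentBundle 𝓘(ℝ, E) N)) x :=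
  hX.self_of_nhds

theorem mdiff (hX : SmoothField X x) :
    MDifferentiableAt 𝓘(ℝ, E) (𝓘(ℝ, E).prod 𝓘(ℝ, E))
      (fun y => (⟨y, X y⟩ : TangentBundle 𝓘(ℝ, E) N)) x :=
  hX.contMDiffAt.mdifferentiableAt (by simp)

theorem congr (hX : SmoothField X x) (h : Y =ᶠ[𝓝 x] X) : SmoothField Y x := by
  filter_upwards [hX, h.eventually_nhds] with y hy hy'
  refine hy.congr_of_eventuallyEq ?_
  filter_upwards [hy'] with w hw
  rw [hw]

theorem add (hX : SmoothField X x) (hY : SmoothField Y x) : SmoothField (X + Y) x := by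
  filter_upwards [hX, hY] with y hy hy' using ContMDiffAt.add_section hy hy'

theorem sub (hX : SmoothField X x) (hY : SmoothField Y x) : SmoothField (X - Y) x := by
  filter_upwards [hX, hY] with y hy hy' using ContMDiffAt.sub_section hy hy'

theorem smul (hf : SmoothFun E f x) (hX : SmoothField X x) : SmoothField (f • X) x := by
  filter_upwards [hf, hX] with y hy hy' using ContMDiffAt.smul_section hy hy'

theorem zero : SmoothField (0 : VField E N) x :=
  Eventually.of_forall fun _ => Bundle.contMDiffAt_zeroSection ℝ _

theorem sum {ι : Type*} {s : Finset ι} {X : ι → VField E N} (hX : ∀ i ∈ s, SmoothField (X i) x) :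
    SmoothField (fun y => ∑ i ∈ s, X i y) x := by
  classical
  induction s using Finset.induction_on with
  | empty => simpa using! zero
  | insert a s ha ih =>
    simp only [Finset.sum_insert ha]
    exact (hX a (by simp)).add (ih fun i hi => hX i (by simp [hi]))

theorem ext (v : TangentSpace 𝓘(ℝ, E) x) : SmoothField (ext v : VField E N) x := by
  obtain ⟨s, hs, h⟩ := exists_contMDiffOn_extend (k := ∞) 𝓘(ℝ, E) E v
  filter_upwards [eventually_mem_nhds_iff.2 hs] with y hy
  exact h.contMDiffAt hy

theorem mlieBracket [FiniteDimensional ℝ E] (hX : SmoothField X x) (hY : SmoothField Y x) :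
    SmoothField (mlieBracket 𝓘(ℝ, E) X Y) x := by
  have : IsManifold 𝓘(ℝ, E) (minSmoothness ℝ 2) N :=
    IsManifold.of_le (n := ∞) (by simpa using WithTop.coe_le_coe.2 (le_top (a := (2 : ℕ∞))))
  have : IsManifold 𝓘(ℝ, E) (((⊤ : ℕ∞) : WithTop ℕ∞) + 1) N := IsManifold.of_le (n := ∞) (by simp)
  have : CompleteSpace E := FiniteDimensional.complete ℝ E
  filter_upwards [hX, hY] with y hy hy'
  exact ContMDiffAt.mlieBracket_vectorField (m := ⊤) (n := ⊤) hy hy' (by simp)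

end SmoothField

@[simp] theorem ext_self {x : N} (v : TangentSpace 𝓘(ℝ, E) x) : (ext v : VField E N) x = v :=
  extend_apply_self E v

end Calculus

/-! ### Derivation rules for directional derivatives. -/

section DirectionalDerivative

variable {E : Type*} [NormedAddCommGroup E] [NormedSpace ℝ E]
  {N : Type*} [TopologicalSpace N] [ChartedSpace E N]

section

variable {X Y : VField E N} {f h : N → ℝ} {x : N}

theorem dirDeriv_eq_mvfderiv (X : VField E N) (f : N → ℝ) (x : N) :
    dirDeriv X f x = mvfderiv 𝓘(ℝ, E) f x (X x) := rfl

theorem mvfderiv_congr (hfh : f =ᶠ[𝓝 x] h) :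
    mvfderiv 𝓘(ℝ, E) f x = mvfderiv 𝓘(ℝ, E) h x := by
  ext v
  simp only [mvfderiv, ContinuousLinearMap.comp_apply]
  rw [hfh.mfderiv_eq]
  rfl

theorem dirDeriv_congr (hfh : f =ᶠ[𝓝 x] h) : dirDeriv X f x = dirDeriv X h x := by
  rw [dirDeriv, dirDeriv, mvfderiv_congr hfh]

theorem dirDeriv_congr_field (hXY : X x = Y x) : dirDeriv X f x = dirDeriv Y f x := by
  rw [dirDeriv, dirDeriv, hXY]

theorem dirDeriv_add_field : dirDeriv (X + Y) f x = dirDeriv X f x + dirDeriv Y f x := by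
  simp [dirDeriv]

theorem dirDeriv_smul_field : dirDeriv (h • X) f x = h x * dirDeriv X f x := by
  simp [dirDeriv]

theorem dirDeriv_const (c : ℝ) : dirDeriv X (fun _ => c) x = 0 := by
  simp [dirDeriv, mvfderiv_const]

theorem dirDeriv_add (hf : SmoothFun E f x) (hh : SmoothFun E h x) :
    dirDeriv X (fun y => f y + h y) x = dirDeriv X f x + dirDeriv X h x := by
  simp [dirDeriv, mvfderiv_fun_add hf.mdiff hh.mdiff]

theorem mvfderiv_mul_apply (hf : SmoothFun E f x) (hh : SmoothFun E h x)
    (v : TangentSpace 𝓘(ℝ, E) x) :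
    mvfderiv 𝓘(ℝ, E) (fun y => f y * h y) x v
      = mvfderiv 𝓘(ℝ, E) f x v * h x + f x * mvfderiv 𝓘(ℝ, E) h x v := by
  simp [mvfderiv_fun_mul hf.mdiff hh.mdiff]
  ring

theorem dirDeriv_mul (hf : SmoothFun E f x) (hh : SmoothFun E h x) :
    dirDeriv X (fun y => f y * h y) x = dirDeriv X f x * h x + f x * dirDeriv X h x :=
  mvfderiv_mul_apply hf hh _

theorem mvfderiv_pow_apply (hf : SmoothFun E f x) (k : ℕ) (v : TangentSpace 𝓘(ℝ, E) x) :
    mvfderiv 𝓘(ℝ, E) (fun y => f y ^ k) x v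
      = k * f x ^ (k - 1) * mvfderiv 𝓘(ℝ, E) f x v := by
  induction k with
  | zero => simp [mvfderiv_const]
  | succ k ih =>
    simp only [pow_succ]
    rw [mvfderiv_mul_apply (hf.pow k) hf, ih]
    rcases k with _ | k
    · simp
    · simp [pow_succ]
      ring

theorem dirDeriv_pow_eq_zero (hf : SmoothFun E f x) (hXf : dirDeriv X f x = 0) (k : ℕ) :
    dirDeriv X (fun y => f y ^ k) x = 0 := by
  rw [dirDeriv_eq_mvfderiv, mvfderiv_pow_apply hf, ← dirDeriv_eq_mvfderiv, hXf, mul_zero]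

/-- Differentiate `f · f⁻¹ = 1`, which holds near `x` because `f` stays nonzero there. -/
theorem mvfderiv_inv_apply (hf : SmoothFun E f x) (h0 : f x ≠ 0) (v : TangentSpace 𝓘(ℝ, E) x) :
    mvfderiv 𝓘(ℝ, E) (fun y => (f y)⁻¹) x v
      = - (f x)⁻¹ ^ 2 * mvfderiv 𝓘(ℝ, E) f x v := by
  have h1 := mvfderiv_mul_apply hf (hf.inv h0) v
  have h2 : (fun y => f y * (f y)⁻¹) =ᶠ[𝓝 x] fun _ => 1 := by
    filter_upwards [hf.contMDiffAt.continuousAt.eventually_ne h0] with y hy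
    exact mul_inv_cancel₀ hy
  rw [mvfderiv_congr h2, mvfderiv_const] at h1
  have h3 : f x * mvfderiv 𝓘(ℝ, E) (fun y => (f y)⁻¹) x v
      = - (mvfderiv 𝓘(ℝ, E) f x v * (f x)⁻¹) := by
    simp only [zero_apply] at h1
    linarith
  field_simp at h3 ⊢
  linarith

end

section Pushforward

variable {F : Type*} [NormedAddCommGroup F] [NormedSpace ℝ F]
  {M : Type*} [TopologicalSpace M] [ChartedSpace F M]
  [IsManifold 𝓘(ℝ, E) ∞ N] [IsManifold 𝓘(ℝ, F) ∞ M]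

/-- Pushing a smooth field forward gives a smooth field along the map. -/
theorem SmoothField.contMDiffAt_mfderiv {φ : N → M} {X : VField E N} {x : N}
    (hφ : ContMDiffAt 𝓘(ℝ, E) 𝓘(ℝ, F) ∞ φ x) (hX : SmoothField X x) :
    ContMDiffAt 𝓘(ℝ, E) (𝓘(ℝ, F).prod 𝓘(ℝ, F)) ∞
      (fun y => (⟨φ y, mfderiv 𝓘(ℝ, E) 𝓘(ℝ, F) φ y (X y)⟩ : TangentBundle 𝓘(ℝ, F) M)) x :=
  ContMDiffAt.clm_apply_of_inCoordinates (b₁ := id) (b₂ := φ)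
    (ϕ := fun y => mfderiv 𝓘(ℝ, E) 𝓘(ℝ, F) φ y) (v := X)
    (hφ.mfderiv_const (m := ∞) (by simp)) hX.contMDiffAt hφ

end Pushforward

variable [IsManifold 𝓘(ℝ, E) ∞ N]

/-- `X(f)` is the fibre component of the pushforward of `X` by `f` into the tangent bundle of `ℝ`.
-/
theorem SmoothFun.dirDeriv {X : VField E N} {f : N → ℝ} {x : N} (hX : SmoothField X x)
    (hf : SmoothFun E f x) : SmoothFun E (dirDeriv X f) x := by
  filter_upwards [hX.eventually, hf] with y hy hy'
  have h := SmoothField.contMDiffAt_mfderiv hy' hy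
  exact (contMDiff_snd_tangentBundle_modelSpace ℝ 𝓘(ℝ, ℝ)).contMDiffAt.comp y h

end DirectionalDerivative

/-! ### Lie brackets of vector fields. -/

section Bracket

variable {E : Type*} [NormedAddCommGroup E] [NormedSpace ℝ E]
  {N : Type*} [TopologicalSpace N] [ChartedSpace E N]
  {X X' Y Y' Z : VField E N} {f : N → ℝ} {x : N}

local notation "⁅" X ", " Y "⁆ₘ" => mlieBracket 𝓘(ℝ, E) X Y

theorem bracket_congr (hX : X =ᶠ[𝓝 x] X') (hY : Y =ᶠ[𝓝 x] Y') : ⁅X, Y⁆ₘ x = ⁅X', Y'⁆ₘ x :=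
  hX.mlieBracket_vectorField_eq hY

variable [IsManifold 𝓘(ℝ, E) ∞ N]

theorem isManifold_minSmoothness (k : ℕ∞) : IsManifold 𝓘(ℝ, E) (minSmoothness ℝ k) N :=
  IsManifold.of_le (n := ∞) (by simp)

variable [FiniteDimensional ℝ E]

theorem completeSpace_model : CompleteSpace E := FiniteDimensional.complete ℝ E

theorem bracket_add_right (hY : SmoothField Y x) (hY' : SmoothField Y' x) :
    ⁅X, Y + Y'⁆ₘ x = ⁅X, Y⁆ₘ x + ⁅X, Y'⁆ₘ x :=
  haveI := completeSpace_model (E := E)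
  haveI : IsManifold 𝓘(ℝ, E) 1 N := IsManifold.of_le (n := ∞) (by simp)
  mlieBracket_add_right hY.mdiff hY'.mdiff

theorem bracket_add_left (hX : SmoothField X x) (hX' : SmoothField X' x) :
    ⁅X + X', Y⁆ₘ x = ⁅X, Y⁆ₘ x + ⁅X', Y⁆ₘ x :=
  haveI := completeSpace_model (E := E)
  haveI : IsManifold 𝓘(ℝ, E) 1 N := IsManifold.of_le (n := ∞) (by simp)
  mlieBracket_add_left hX.mdiff hX'.mdiff

theorem bracket_smul_right (hf : SmoothFun E f x) (hY : SmoothField Y x) :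
    ⁅X, f • Y⁆ₘ x = dirDeriv X f x • Y x + f x • ⁅X, Y⁆ₘ x :=
  haveI := completeSpace_model (E := E)
  haveI : IsManifold 𝓘(ℝ, E) 1 N := IsManifold.of_le (n := ∞) (by simp)
  mlieBracket_smul_right hf.mdiff hY.mdiff

theorem bracket_smul_left (hf : SmoothFun E f x) (hX : SmoothField X x) :
    ⁅f • X, Y⁆ₘ x = - dirDeriv Y f x • X x + f x • ⁅X, Y⁆ₘ x :=
  haveI := completeSpace_model (E := E)
  haveI : IsManifold 𝓘(ℝ, E) 1 N := IsManifold.of_le (n := ∞) (by simp)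
  mlieBracket_smul_left hf.mdiff hX.mdiff

theorem jacobi (hX : SmoothField X x) (hY : SmoothField Y x) (hZ : SmoothField Z x) :
    ⁅X, ⁅Y, Z⁆ₘ⁆ₘ x = ⁅⁅X, Y⁆ₘ, Z⁆ₘ x + ⁅Y, ⁅X, Z⁆ₘ⁆ₘ x := by
  have := completeSpace_model (E := E)
  have : IsManifold 𝓘(ℝ, E) (minSmoothness ℝ 3) N := isManifold_minSmoothness 3
  have h2 : minSmoothness ℝ 2 ≤ (∞ : WithTop ℕ∞) := by
    simpa using WithTop.coe_le_coe.2 (le_top (a := (2 : ℕ∞)))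
  exact leibniz_identity_mlieBracket_apply (hX.contMDiffAt.of_le h2) (hY.contMDiffAt.of_le h2)
    (hZ.contMDiffAt.of_le h2)

/-- The bracket of two fields acts on functions as the commutator. This is read off from the
Jacobi identity for `X`, `Y` and `f Z`. -/
theorem dirDeriv_bracket (hX : SmoothField X x) (hY : SmoothField Y x) (hf : SmoothFun E f x) :
    dirDeriv ⁅X, Y⁆ₘ f x = dirDeriv X (dirDeriv Y f) x - dirDeriv Y (dirDeriv X f) x := by
  -- The argument compares coefficients of a nonvanishing `Z`, so dimension zero is treated apart.
  rcases subsingleton_or_nontrivial E with hE | hE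
  · have h0 (V : VField E N) (h : N → ℝ) : dirDeriv V h x = 0 := by
      have : V x = 0 := Subsingleton.elim (α := E) _ _
      simp [dirDeriv, this]
    simp [h0]
  obtain ⟨v, hv⟩ := exists_ne (0 : E)
  set Z : VField E N := ext (x := x) v
  have hZ : SmoothField Z x := SmoothField.ext _
  have hZx : Z x = v := ext_self (x := x) v
  have smooth_bracket {A B : VField E N} (hA : SmoothField A x) (hB : SmoothField B x) :
      SmoothField ⁅A, B⁆ₘ x := hA.mlieBracket hB
  have step (A B : VField E N) (hA : SmoothField A x) (hB : SmoothField B x) :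
      ⁅A, ⁅B, f • Z⁆ₘ⁆ₘ x = dirDeriv A (dirDeriv B f) x • Z x + dirDeriv B f x • ⁅A, Z⁆ₘ x
        + (dirDeriv A f x • ⁅B, Z⁆ₘ x + f x • ⁅A, ⁅B, Z⁆ₘ⁆ₘ x) := by
    have e : ⁅B, f • Z⁆ₘ =ᶠ[𝓝 x] dirDeriv B f • Z + f • ⁅B, Z⁆ₘ := by
      filter_upwards [hf.eventually, hZ.eventually] with y hfy hZy
      exact bracket_smul_right hfy hZy
    refine (bracket_congr EventuallyEq.rfl e).trans ?_
    rw [bracket_add_right ((SmoothField.smul (hf.dirDeriv hB) hZ))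
        (SmoothField.smul hf (smooth_bracket hB hZ)),
      bracket_smul_right (hf.dirDeriv hB) hZ, bracket_smul_right hf (smooth_bracket hB hZ)]
  have h1 := jacobi hX hY (SmoothField.smul hf hZ)
  rw [step X Y hX hY, step Y X hY hX, bracket_smul_right hf hZ, jacobi hX hY hZ] at h1
  -- All brackets cancel in the expanded identity, by the Jacobi identity for `X`, `Y`, `Z`; only a
  -- multiple of `Z x` survives.
  have h2 : (dirDeriv X (dirDeriv Y f) x - dirDeriv Y (dirDeriv X f) x
      - dirDeriv ⁅X, Y⁆ₘ f x) • Z x = 0 := by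
    rw [← sub_eq_zero] at h1
    rw [← h1]
    module
  rw [smul_eq_zero] at h2
  rcases h2 with h2 | h2
  · linarith
  · exact absurd (hZx ▸ h2) hv

end Bracket

/-! ### Operations linear over functions, and local frames. -/

section Tensoriality

variable {E : Type*} [NormedAddCommGroup E] [NormedSpace ℝ E]
  {N : Type*} [TopologicalSpace N] [ChartedSpace E N] [IsManifold 𝓘(ℝ, E) ∞ N]
  {A : Type*} [AddCommGroup A] [Module ℝ A]

/-- An operation on vector fields is linear over the germs of smooth functions at `x`. -/
structure IsTensorialAt (Ψ : VField E N → A) (x : N) : Prop where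
  smul : ∀ {f : N → ℝ} {X : VField E N}, SmoothFun E f x → SmoothField X x →
    Ψ (f • X) = f x • Ψ X
  add : ∀ {X Y : VField E N}, SmoothField X x → SmoothField Y x → Ψ (X + Y) = Ψ X + Ψ Y

namespace IsTensorialAt

variable {Ψ : VField E N → A} {X Y : VField E N} {x : N}

/-- The indicator `ψ` of the set where the fields agree replaces a bump function: it equals `1` near
`x`, hence is smooth there, which is all that tensoriality asks, and `ψ Y = ψ X` everywhere. -/
theorem congr_germ (hΨ : IsTensorialAt Ψ x) (hX : SmoothField X x) (hXY : Y =ᶠ[𝓝 x] X) :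
    Ψ Y = Ψ X := by
  classical
  let ψ (y : N) : ℝ := if Y y = X y then 1 else 0
  have hψx : ψ x = 1 := by simp [ψ, hXY.self_of_nhds]
  have h1 : ψ • Y = ψ • X := by
    funext y
    by_cases hy : Y y = X y <;> simp [ψ, hy]
  have hψ : SmoothFun E ψ x := (SmoothFun.const 1).congr (hXY.mono fun y hy => by simp [ψ, hy])
  calc Ψ Y = Ψ (ψ • Y) := by rw [hΨ.smul hψ (hX.congr hXY), hψx, one_smul]
    _ = Ψ (ψ • X) := by rw [h1]
    _ = Ψ X := by rw [hΨ.smul hψ hX, hψx, one_smul]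

theorem map_zero (hΨ : IsTensorialAt Ψ x) : Ψ 0 = 0 := by
  have h := hΨ.smul (SmoothFun.const 0) (SmoothField.zero (x := x))
  have h0 : ((fun _ => (0 : ℝ)) : N → ℝ) • (0 : VField E N) = 0 := by
    funext y
    simp
  rw [h0] at h
  simpa using h

theorem map_sum (hΨ : IsTensorialAt Ψ x) {ι : Type*} {s : Finset ι} {X : ι → VField E N}
    (hX : ∀ i ∈ s, SmoothField (X i) x) :
    Ψ (fun y => ∑ i ∈ s, X i y) = ∑ i ∈ s, Ψ (X i) := by
  classical
  induction s using Finset.induction_on with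
  | empty => simpa using! hΨ.map_zero
  | insert a s ha ih =>
    simp only [Finset.sum_insert ha]
    rw [← ih fun i hi => hX i (by simp [hi])]
    exact hΨ.add (hX a (by simp)) (SmoothField.sum fun i hi => hX i (by simp [hi]))

end IsTensorialAt

variable [FiniteDimensional ℝ E]

variable (E) in
/-- The frame of coordinate fields near `x`. -/
def frame (x : N) (i : Fin (Module.finrank ℝ E)) : VField E N :=
  (trivializationAt E (TangentSpace 𝓘(ℝ, E)) x).localFrame (Module.finBasis ℝ E) i

/-- The coefficients of a vector field in the frame `frame E x`. -/
def frameCoeff (x : N) (i : Fin (Module.finrank ℝ E)) (X : VField E N) (y : N) : ℝ :=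
  haveI : IsManifold 𝓘(ℝ, E) 1 N := IsManifold.of_le (n := ∞) (by simp)
  (trivializationAt E (TangentSpace 𝓘(ℝ, E)) x).localFrameCoeff 𝓘(ℝ, E)
    (Module.finBasis ℝ E) i y (X y)

theorem smoothField_frame (x : N) (i : Fin (Module.finrank ℝ E)) :
    SmoothField (frame E x i) x := by
  set t := trivializationAt E (TangentSpace 𝓘(ℝ, E)) x
  filter_upwards [t.open_baseSet.mem_nhds (FiberBundle.mem_baseSet_trivializationAt' x)] with y hy
  exact contMDiffAt_localFrame_of_mem ∞ t (Module.finBasis ℝ E) i hy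

theorem smoothFun_frameCoeff {X : VField E N} {x : N} (hX : SmoothField X x)
    (i : Fin (Module.finrank ℝ E)) : SmoothFun E (frameCoeff x i X) x := by
  set t := trivializationAt E (TangentSpace 𝓘(ℝ, E)) x
  have : IsManifold 𝓘(ℝ, E) 1 N := IsManifold.of_le (n := ∞) (by simp)
  filter_upwards [t.open_baseSet.mem_nhds (FiberBundle.mem_baseSet_trivializationAt' x), hX]
    with y hy hXy
  exact contMDiffAt_localFrameCoeff (Module.finBasis ℝ E) hy hXy i

/-- One neighbourhood, the domain of the trivialization, serves all fields at once, including fields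
whose smoothness is yet to be proved through their coefficients. -/
theorem eventually_eq_sum_frame (x : N) :
    ∀ᶠ y in 𝓝 x, ∀ X : VField E N, X y = ∑ i, frameCoeff x i X y • frame E x i y := by
  set t := trivializationAt E (TangentSpace 𝓘(ℝ, E)) x
  have : IsManifold 𝓘(ℝ, E) 1 N := IsManifold.of_le (n := ∞) (by simp)
  filter_upwards [t.open_baseSet.mem_nhds (FiberBundle.mem_baseSet_trivializationAt' x)] with y hy X
  exact t.eq_sum_localFrameCoeff_smul hy

theorem frameCoeff_congr {x y : N} {X Y : VField E N} (h : X y = Y y)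
    (i : Fin (Module.finrank ℝ E)) : frameCoeff x i X y = frameCoeff x i Y y := by
  simp only [frameCoeff, h]

/-- A field is smooth near `x` if its coefficients in the frame are. -/
theorem SmoothField.of_frameCoeff {X : VField E N} {x : N}
    (h : ∀ i, SmoothFun E (frameCoeff x i X) x) : SmoothField X x := by
  refine (SmoothField.sum (s := Finset.univ) (fun i _ =>
    SmoothField.smul (h i) (smoothField_frame x i))).congr ?_
  filter_upwards [eventually_eq_sum_frame (E := E) x] with y hy
  exact hy X

namespace IsTensorialAt

variable {Ψ : VField E N → A} {X Y : VField E N} {x : N}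

theorem eq_sum_frame (hΨ : IsTensorialAt Ψ x) (hX : SmoothField X x) :
    Ψ X = ∑ i, frameCoeff x i X x • Ψ (frame E x i) := by
  have hc := fun i => smoothFun_frameCoeff hX i
  have hs := fun i => smoothField_frame (E := E) x i
  have h : X =ᶠ[𝓝 x] fun y => ∑ i, (frameCoeff x i X • frame E x i) y := by
    filter_upwards [eventually_eq_sum_frame (E := E) x] with y hy
    exact hy X
  rw [hΨ.congr_germ (SmoothField.sum fun i _ => SmoothField.smul (hc i) (hs i)) h,
    hΨ.map_sum fun i _ => SmoothField.smul (hc i) (hs i)]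
  exact Finset.sum_congr rfl fun i _ => hΨ.smul (hc i) (hs i)

/-- A tensorial operation depends only on the value of the field at the point. -/
theorem congr_point (hΨ : IsTensorialAt Ψ x) (hX : SmoothField X x) (hY : SmoothField Y x)
    (hXY : X x = Y x) : Ψ X = Ψ Y := by
  rw [hΨ.eq_sum_frame hX, hΨ.eq_sum_frame hY]
  simp only [frameCoeff_congr hXY]

/-- The bridge from definitions stated with the chosen extension `ext` to arbitrary smooth fields.
-/
theorem eq_ext (hΨ : IsTensorialAt Ψ x) (hX : SmoothField X x) : Ψ X = Ψ (ext (X x)) :=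
  hΨ.congr_point hX (SmoothField.ext _) (ext_self _).symm

theorem ext_add (hΨ : IsTensorialAt Ψ x) (v w : TangentSpace 𝓘(ℝ, E) x) :
    Ψ (ext (v + w)) = Ψ (ext v) + Ψ (ext w) := by
  rw [← hΨ.add (SmoothField.ext v) (SmoothField.ext w)]
  exact hΨ.congr_point (SmoothField.ext _) ((SmoothField.ext v).add (SmoothField.ext w)) (by simp)

theorem ext_smul (hΨ : IsTensorialAt Ψ x) (c : ℝ) (v : TangentSpace 𝓘(ℝ, E) x) :
    Ψ (ext (c • v)) = c • Ψ (ext v) := by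
  rw [← hΨ.smul (SmoothFun.const c) (SmoothField.ext v)]
  exact hΨ.congr_point (SmoothField.ext _) (SmoothField.smul (SmoothFun.const c) (SmoothField.ext v))
    (by simp)

/-- The linear map on the tangent space defined by a tensorial operation. -/
def toLinearMap (hΨ : IsTensorialAt Ψ x) : TangentSpace 𝓘(ℝ, E) x →ₗ[ℝ] A where
  toFun v := Ψ (ext v)
  map_add' := hΨ.ext_add
  map_smul' := hΨ.ext_smul

theorem toLinearMap_apply (hΨ : IsTensorialAt Ψ x) (hX : SmoothField X x) :
    hΨ.toLinearMap (X x) = Ψ X := (hΨ.eq_ext hX).symm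

theorem toLinearMap_ext (hΨ : IsTensorialAt Ψ x) (v : TangentSpace 𝓘(ℝ, E) x) :
    hΨ.toLinearMap v = Ψ (ext v) := rfl

end IsTensorialAt

end Tensoriality

/-! ### The Levi-Civita connection from the Koszul formula. -/

section LeviCivita

variable {F : Type*} [NormedAddCommGroup F] [NormedSpace ℝ F]
  {M : Type*} [TopologicalSpace M] [ChartedSpace F M] [IsManifold 𝓘(ℝ, F) ∞ M]

theorem raise_spec {V : Type*} [AddCommGroup V] [Module ℝ V] [FiniteDimensional ℝ V]
    {B : LinearMap.BilinForm ℝ V} (hB : B.Nondegenerate) (φ : Module.Dual ℝ V) (v : V) :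
    B (raise B φ) v = φ v := by
  rw [raise, dif_pos hB, ← LinearMap.BilinForm.toDual_def hB, LinearEquiv.apply_symm_apply]

theorem raise_eq {V : Type*} [AddCommGroup V] [Module ℝ V] [FiniteDimensional ℝ V]
    {B : LinearMap.BilinForm ℝ V} (hB : B.Nondegenerate) {φ : Module.Dual ℝ V} {u : V}
    (h : ∀ v, B u v = φ v) : raise B φ = u := by
  rw [raise, dif_pos hB, LinearEquiv.symm_apply_eq]
  ext v
  rw [LinearMap.BilinForm.toDual_def, h]

namespace SemiRiemannianMetric

variable (g : SemiRiemannianMetric F M) {X X' Y Y' Z Z' : VField F M} {f : M → ℝ} {x : M}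

local notation "⁅" X ", " Y "⁆ₘ" => mlieBracket 𝓘(ℝ, F) X Y

@[simp] theorem toCov2_add_left (v v' w : TangentSpace 𝓘(ℝ, F) x) :
    g.toCov2 x (v + v') w = g.toCov2 x v w + g.toCov2 x v' w := by simp [toCov2]

@[simp] theorem toCov2_add_right (v w w' : TangentSpace 𝓘(ℝ, F) x) :
    g.toCov2 x v (w + w') = g.toCov2 x v w + g.toCov2 x v w' := by simp [toCov2]

@[simp] theorem toCov2_sub_left (v v' w : TangentSpace 𝓘(ℝ, F) x) :
    g.toCov2 x (v - v') w = g.toCov2 x v w - g.toCov2 x v' w := by simp [toCov2]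

@[simp] theorem toCov2_sub_right (v w w' : TangentSpace 𝓘(ℝ, F) x) :
    g.toCov2 x v (w - w') = g.toCov2 x v w - g.toCov2 x v w' := by simp [toCov2]

@[simp] theorem toCov2_smul_left (c : ℝ) (v w : TangentSpace 𝓘(ℝ, F) x) :
    g.toCov2 x (c • v) w = c * g.toCov2 x v w := by simp [toCov2]

@[simp] theorem toCov2_smul_right (c : ℝ) (v w : TangentSpace 𝓘(ℝ, F) x) :
    g.toCov2 x v (c • w) = c * g.toCov2 x v w := by simp [toCov2]

@[simp] theorem toCov2_neg_left (v w : TangentSpace 𝓘(ℝ, F) x) :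
    g.toCov2 x (-v) w = - g.toCov2 x v w := by simp [toCov2]

theorem toCov2_symm (v w : TangentSpace 𝓘(ℝ, F) x) : g.toCov2 x v w = g.toCov2 x w v :=
  g.symm x v w

theorem eq_of_toCov2 {u u' : TangentSpace 𝓘(ℝ, F) x}
    (h : ∀ v, g.toCov2 x u v = g.toCov2 x u' v) : u = u' := by
  have := (g.nondegenerate x).1 (u - u') (fun v => by
    have := h v
    simp only [toCov2] at this
    simp [this])
  exact sub_eq_zero.1 this

theorem smoothFun_toCov2 (hX : SmoothField X x) (hY : SmoothField Y x) :
    SmoothFun F (fun y => g.toCov2 y (X y) (Y y)) x := by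
  filter_upwards [hX, hY] with y hXy hYy
  have h := ContMDiffAt.clm_bundle_apply₂ (E₃ := Bundle.Trivial M ℝ) (F₃ := ℝ) (b := id)
    (g.contMDiff y) hXy hYy
  rw [Bundle.contMDiffAt_totalSpace] at h
  exact h.2

variable [FiniteDimensional ℝ F]

/-- The derivatives of `f` from the Leibniz rule cancel those from the brackets. This also happens
in the first slot; in the middle one a term survives and yields the Leibniz rule of `∇`. -/
theorem koszul_tensorial_right (hX : SmoothField X x) (hY : SmoothField Y x) :
    IsTensorialAt (fun Z => koszul g.toCov2 X Y Z x) x where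
  smul {f Z} hf hZ := by
    have h1 := g.smoothFun_toCov2 hY hZ
    have h2 := g.smoothFun_toCov2 hX hZ
    simp only [koszul, Pi.smul_apply', toCov2_smul_right, toCov2_smul_left, toCov2_add_left,
      dirDeriv_mul hf h1, dirDeriv_mul hf h2, dirDeriv_smul_field, bracket_smul_right hf hZ,
      smul_eq_mul, g.toCov2_symm (Z x)]
    ring
  add {Z Z'} hZ hZ' := by
    simp only [koszul, Pi.add_apply, toCov2_add_right, toCov2_add_left,
      dirDeriv_add (g.smoothFun_toCov2 hY hZ) (g.smoothFun_toCov2 hY hZ'),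
      dirDeriv_add (g.smoothFun_toCov2 hX hZ) (g.smoothFun_toCov2 hX hZ'),
      dirDeriv_add_field, bracket_add_right hZ hZ']
    ring

theorem koszul_tensorial_left (hY : SmoothField Y x) (hZ : SmoothField Z x) :
    IsTensorialAt (fun X => koszul g.toCov2 X Y Z x) x where
  smul {f X} hf hX := by
    have h1 := g.smoothFun_toCov2 hX hY
    have h2 := g.smoothFun_toCov2 hX hZ
    simp only [koszul, Pi.smul_apply', toCov2_smul_right, toCov2_smul_left, toCov2_add_left,
      dirDeriv_mul hf h1, dirDeriv_mul hf h2, dirDeriv_smul_field, bracket_smul_left hf hX,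
      smul_eq_mul]
    ring
  add {X X'} hX hX' := by
    simp only [koszul, Pi.add_apply, toCov2_add_right, toCov2_add_left,
      dirDeriv_add (g.smoothFun_toCov2 hX hY) (g.smoothFun_toCov2 hX' hY),
      dirDeriv_add (g.smoothFun_toCov2 hX hZ) (g.smoothFun_toCov2 hX' hZ),
      dirDeriv_add_field, bracket_add_left hX hX']
    ring

theorem koszul_smul_mid (hf : SmoothFun F f x) (hX : SmoothField X x) (hY : SmoothField Y x)
    (hZ : SmoothField Z x) :
    koszul g.toCov2 X (f • Y) Z x
      = f x * koszul g.toCov2 X Y Z x + dirDeriv X f x * g.toCov2 x (Y x) (Z x) := by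
  have h1 := g.smoothFun_toCov2 hX hY
  have h2 := g.smoothFun_toCov2 hY hZ
  simp only [koszul, Pi.smul_apply', toCov2_smul_right, toCov2_smul_left, toCov2_add_left,
    dirDeriv_mul hf h1, dirDeriv_mul hf h2, dirDeriv_smul_field, bracket_smul_left hf hY,
    bracket_smul_right hf hY]
  rw [g.toCov2_symm (Y x) (X x)]
  ring

theorem koszul_add_mid (hX : SmoothField X x) (hY : SmoothField Y x) (hY' : SmoothField Y' x)
    (hZ : SmoothField Z x) :
    koszul g.toCov2 X (Y + Y') Z x
      = koszul g.toCov2 X Y Z x + koszul g.toCov2 X Y' Z x := by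
  simp only [koszul, Pi.add_apply, toCov2_add_right, toCov2_add_left,
    dirDeriv_add (g.smoothFun_toCov2 hY hZ) (g.smoothFun_toCov2 hY' hZ),
    dirDeriv_add (g.smoothFun_toCov2 hX hY) (g.smoothFun_toCov2 hX hY'),
    dirDeriv_add_field, bracket_add_left hY hY', bracket_add_right hY hY']
  ring

/-- The Koszul formula. -/
theorem toCov2_nabla (hX : SmoothField X x) (hY : SmoothField Y x) (hZ : SmoothField Z x) :
    g.toCov2 x (g.nabla X Y x) (Z x) = koszul g.toCov2 X Y Z x := by
  have hΨ := g.koszul_tensorial_right hX hY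
  set b := Module.finBasis ℝ (TangentSpace 𝓘(ℝ, F) x)
  have h1 (φ : Module.Dual ℝ (TangentSpace 𝓘(ℝ, F) x)) :
      g.inner x (raise (g.inner x).toBilinForm φ) (Z x) = φ (Z x) :=
    raise_spec (g.nondegenerate x) φ (Z x)
  rw [← hΨ.toLinearMap_apply hZ]
  conv_rhs => rw [← b.sum_repr (Z x), map_sum]
  simp only [toCov2, nabla, map_sum, map_smul, sum_apply,
    smul_apply, h1, smul_eq_mul]
  refine Finset.sum_congr rfl fun i _ => ?_
  rw [mul_comm]
  rfl

theorem toCov2_nabla_ext (hX : SmoothField X x) (hY : SmoothField Y x)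
    (v : TangentSpace 𝓘(ℝ, F) x) :
    g.toCov2 x (g.nabla X Y x) v = koszul g.toCov2 X Y (ext v) x := by
  rw [← g.toCov2_nabla hX hY (SmoothField.ext v), ext_self]

/-- By the Koszul formula the frame coefficients of `∇_X Y` solve a linear system with smooth
right-hand side, whose matrix is the Gram matrix of the frame, invertible because `g` is
nondegenerate. -/
theorem _root_.HypersurfaceData.SmoothField.nabla (hX : SmoothField X x) (hY : SmoothField Y x) :
    SmoothField (g.nabla X Y) x := by
  refine SmoothField.of_frameCoeff fun i => ?_
  have hs (i) : SmoothField (frame F x i) x := smoothField_frame x i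
  have hx := FiberBundle.mem_baseSet_trivializationAt' (F := F) (E := TangentSpace 𝓘(ℝ, F)) x
  refine SmoothFun.of_linear_system
    (G := fun y => Matrix.of fun i j => g.toCov2 y (frame F x i y) (frame F x j y))
    (u := fun i => frameCoeff x i (g.nabla X Y))
    (c := fun j y => koszul g.toCov2 X Y (frame F x j) y)
    (fun i j => g.smoothFun_toCov2 (hs i) (hs j)) ?_ (fun j => ?_) ?_ i
  · have := (LinearMap.BilinForm.nondegenerate_iff_det_ne_zero
      ((trivializationAt F (TangentSpace 𝓘(ℝ, F)) x).basisAt (Module.finBasis ℝ F) hx)).1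
      (g.nondegenerate x)
    convert! this using 3
    funext i j
    simp [toCov2, frame, Bundle.Trivialization.localFrame_apply_of_mem_baseSet _ _ hx]
  · have hXY := hX.mlieBracket hY
    have hXs := hX.mlieBracket (hs j)
    have hYs := hY.mlieBracket (hs j)
    exact (SmoothFun.const _).mul
      (((((((g.smoothFun_toCov2 hY (hs j)).dirDeriv hX).add
        ((g.smoothFun_toCov2 hX (hs j)).dirDeriv hY)).sub
        ((g.smoothFun_toCov2 hX hY).dirDeriv (hs j))).add
        (g.smoothFun_toCov2 hXY (hs j))).sub (g.smoothFun_toCov2 hXs hY)).sub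
        (g.smoothFun_toCov2 hYs hX))
  · filter_upwards [eventually_eq_sum_frame (E := F) x, hX.eventually, hY.eventually,
      eventually_all.2 fun j => (hs j).eventually] with y hy hXy hYy hsy j
    rw [← g.toCov2_nabla hXy hYy (hsy j), hy (g.nabla X Y)]
    simp [toCov2]

theorem nabla_add_left (hX : SmoothField X x) (hX' : SmoothField X' x) (hY : SmoothField Y x) :
    g.nabla (X + X') Y x = g.nabla X Y x + g.nabla X' Y x := by
  refine g.eq_of_toCov2 fun v => ?_
  rw [toCov2_add_left, g.toCov2_nabla_ext (hX.add hX') hY, g.toCov2_nabla_ext hX hY,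
    g.toCov2_nabla_ext hX' hY]
  exact (g.koszul_tensorial_left hY (SmoothField.ext v)).add hX hX'

theorem nabla_smul_left (hf : SmoothFun F f x) (hX : SmoothField X x) (hY : SmoothField Y x) :
    g.nabla (f • X) Y x = f x • g.nabla X Y x := by
  refine g.eq_of_toCov2 fun v => ?_
  rw [toCov2_smul_left, g.toCov2_nabla_ext (SmoothField.smul hf hX) hY, g.toCov2_nabla_ext hX hY]
  exact (g.koszul_tensorial_left hY (SmoothField.ext v)).smul hf hX

theorem nabla_add_right (hX : SmoothField X x) (hY : SmoothField Y x) (hY' : SmoothField Y' x) :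
    g.nabla X (Y + Y') x = g.nabla X Y x + g.nabla X Y' x := by
  refine g.eq_of_toCov2 fun v => ?_
  rw [toCov2_add_left, g.toCov2_nabla_ext hX (hY.add hY'), g.toCov2_nabla_ext hX hY,
    g.toCov2_nabla_ext hX hY', g.koszul_add_mid hX hY hY' (SmoothField.ext v)]

theorem nabla_smul_right (hf : SmoothFun F f x) (hX : SmoothField X x) (hY : SmoothField Y x) :
    g.nabla X (f • Y) x = dirDeriv X f x • Y x + f x • g.nabla X Y x := by
  refine g.eq_of_toCov2 fun v => ?_
  rw [toCov2_add_left, toCov2_smul_left, toCov2_smul_left,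
    g.toCov2_nabla_ext hX (SmoothField.smul hf hY), g.toCov2_nabla_ext hX hY,
    g.koszul_smul_mid hf hX hY (SmoothField.ext v), ext_self]
  ring

/-- Needed for second derivatives, where the inner covariant derivative is rewritten only near `x`.
-/
theorem nabla_congr (hX : X =ᶠ[𝓝 x] X') (hY : Y =ᶠ[𝓝 x] Y') :
    g.nabla X Y x = g.nabla X' Y' x := by
  have hd {A A' B B' : VField F M} (hA : A =ᶠ[𝓝 x] A') (hB : B =ᶠ[𝓝 x] B') (C : VField F M) :
      dirDeriv C (fun y => g.toCov2 y (A y) (B y)) x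
        = dirDeriv C (fun y => g.toCov2 y (A' y) (B' y)) x := by
    refine dirDeriv_congr ?_
    filter_upwards [hA, hB] with y h h'
    rw [h, h']
  have h0 (Z : VField F M) : koszul g.toCov2 X Y Z x = koszul g.toCov2 X' Y' Z x := by
    have hZ : Z =ᶠ[𝓝 x] Z := EventuallyEq.rfl
    simp only [koszul, hd hY hZ, hd hX hZ, hd hX hY, bracket_congr hX hY, bracket_congr hX hZ,
      bracket_congr hY hZ, hX.self_of_nhds, hY.self_of_nhds,
      dirDeriv_congr_field hX.self_of_nhds, dirDeriv_congr_field hY.self_of_nhds]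
  simp only [nabla, h0]

theorem nabla_congr_right (hY : Y =ᶠ[𝓝 x] Y') : g.nabla X Y x = g.nabla X Y' x :=
  g.nabla_congr EventuallyEq.rfl hY

theorem nabla_congr_left (hX : X =ᶠ[𝓝 x] X') : g.nabla X Y x = g.nabla X' Y x :=
  g.nabla_congr hX EventuallyEq.rfl

theorem nabla_torsion_free (hX : SmoothField X x) (hY : SmoothField Y x) :
    g.nabla X Y x - g.nabla Y X x = ⁅X, Y⁆ₘ x := by
  refine g.eq_of_toCov2 fun v => ?_
  rw [toCov2_sub_left, g.toCov2_nabla_ext hX hY, g.toCov2_nabla_ext hY hX]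
  simp only [koszul, mlieBracket_swap_apply (V := Y) (W := X), toCov2_neg_left,
    fun y => g.toCov2_symm (Y y) (X y), ext_self]
  ring

theorem nabla_metric (hX : SmoothField X x) (hY : SmoothField Y x) (hZ : SmoothField Z x) :
    dirDeriv X (fun y => g.toCov2 y (Y y) (Z y)) x
      = g.toCov2 x (g.nabla X Y x) (Z x) + g.toCov2 x (Y x) (g.nabla X Z x) := by
  rw [g.toCov2_symm (Y x), g.toCov2_nabla hX hY hZ, g.toCov2_nabla hX hZ hY]
  simp only [koszul, mlieBracket_swap_apply (V := Z) (W := Y), toCov2_neg_left,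
    fun y => g.toCov2_symm (Z y) (Y y)]
  ring

end SemiRiemannianMetric

end LeviCivita

/-! ### Symmetries of the curvature and smoothness of the Ricci tensor. -/

section Curvature

variable {F : Type*} [NormedAddCommGroup F] [NormedSpace ℝ F] [FiniteDimensional ℝ F]
  {M : Type*} [TopologicalSpace M] [ChartedSpace F M] [IsManifold 𝓘(ℝ, F) ∞ M]

/-- The trace in terms of a basis. -/
theorem sum_coord_eq_trace {V ι : Type*} [AddCommGroup V] [Module ℝ V] [Fintype ι]
    (b : Module.Basis ι ℝ V) (A : V →ₗ[ℝ] V) :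
    ∑ i, b.coord i (A (b i)) = LinearMap.trace ℝ V A := by
  classical
  rw [LinearMap.trace_eq_matrix_trace ℝ b]
  simp [Matrix.trace, LinearMap.toMatrix_apply]

/-- A skew-adjoint operator has trace zero. -/
theorem trace_eq_zero_of_skew {V : Type*} [AddCommGroup V] [Module ℝ V] [FiniteDimensional ℝ V]
    {B : LinearMap.BilinForm ℝ V} (hB : B.Nondegenerate) {A : V →ₗ[ℝ] V}
    (hA : ∀ u v, B (A u) v = - B u (A v)) : LinearMap.trace ℝ V A = 0 := by
  -- Lowering an index by `B` conjugates `-A` into the transpose of `A`, so `-tr A = tr A`.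
  have h : (B.toDual hB).conj (-A) = Module.Dual.transpose (R := ℝ) A := by
    ext φ v
    obtain ⟨u, rfl⟩ := (B.toDual hB).surjective φ
    simp [LinearEquiv.conj_apply, LinearMap.BilinForm.toDual_def, Module.Dual.transpose_apply, hA]
  have h1 := LinearMap.trace_conj' (-A) (B.toDual hB)
  rw [h, map_neg, LinearMap.trace_transpose'] at h1
  linarith

namespace SemiRiemannianMetric

variable (g : SemiRiemannianMetric F M) {X X' Y Y' Z Z' : VField F M} {f : M → ℝ} {x : M}

local notation "⁅" X ", " Y "⁆ₘ" => mlieBracket 𝓘(ℝ, F) X Y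

theorem nabla_neg_left (hX : SmoothField X x) (hY : SmoothField Y x) :
    g.nabla (-X) Y x = - g.nabla X Y x := by
  have h := g.nabla_smul_left (SmoothFun.const (-1)) hX hY
  have e : ((fun _ => (-1 : ℝ)) : M → ℝ) • X = -X := by
    funext y
    simp
  rw [e] at h
  simpa using h

theorem _root_.HypersurfaceData.SmoothField.riemann (hX : SmoothField X x) (hY : SmoothField Y x)
    (hZ : SmoothField Z x) : SmoothField (g.riemann X Y Z) x :=
  ((hX.nabla g (hY.nabla g hZ)).sub (hY.nabla g (hX.nabla g hZ))).sub
    ((hX.mlieBracket hY).nabla g hZ)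

theorem riemann_antisymm (hX : SmoothField X x) (hY : SmoothField Y x) (hZ : SmoothField Z x) :
    g.riemann X Y Z x = - g.riemann Y X Z x := by
  rw [riemann, riemann, mlieBracket_swap (V := Y), g.nabla_neg_left (hX.mlieBracket hY) hZ]
  abel

theorem riemann_tensorial_left (hY : SmoothField Y x) (hZ : SmoothField Z x) :
    IsTensorialAt (fun X => g.riemann X Y Z x) x where
  smul {f X} hf hX := by
    have hYf := hf.dirDeriv hY
    have e1 : g.nabla (f • X) Z =ᶠ[𝓝 x] f • g.nabla X Z := by
      filter_upwards [hf.eventually, hX.eventually, hZ.eventually] with y h1 h2 h3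
      exact g.nabla_smul_left h1 h2 h3
    have e2 : ⁅f • X, Y⁆ₘ =ᶠ[𝓝 x] (fun y => - dirDeriv Y f y) • X + f • ⁅X, Y⁆ₘ := by
      filter_upwards [hf.eventually, hX.eventually] with y h1 h2
      exact bracket_smul_left h1 h2
    have hXY := hX.mlieBracket hY
    simp only [riemann]
    rw [g.nabla_smul_left hf hX (hY.nabla g hZ), g.nabla_congr_right e1,
      g.nabla_smul_right hf hY (hX.nabla g hZ), g.nabla_congr_left e2,
      g.nabla_add_left (SmoothField.smul hYf.neg hX) (SmoothField.smul hf hXY) hZ,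
      g.nabla_smul_left hYf.neg hX hZ, g.nabla_smul_left hf hXY hZ]
    module
  add {X X'} hX hX' := by
    have e1 : g.nabla (X + X') Z =ᶠ[𝓝 x] g.nabla X Z + g.nabla X' Z := by
      filter_upwards [hX.eventually, hX'.eventually, hZ.eventually] with y h1 h2 h3
      exact g.nabla_add_left h1 h2 h3
    have e2 : ⁅X + X', Y⁆ₘ =ᶠ[𝓝 x] ⁅X, Y⁆ₘ + ⁅X', Y⁆ₘ := by
      filter_upwards [hX.eventually, hX'.eventually] with y h1 h2
      exact bracket_add_left h1 h2
    simp only [riemann]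
    rw [g.nabla_add_left hX hX' (hY.nabla g hZ), g.nabla_congr_right e1,
      g.nabla_add_right hY (hX.nabla g hZ) (hX'.nabla g hZ), g.nabla_congr_left e2,
      g.nabla_add_left (hX.mlieBracket hY) (hX'.mlieBracket hY) hZ]
    abel

theorem riemann_tensorial_mid (hX : SmoothField X x) (hZ : SmoothField Z x) :
    IsTensorialAt (fun Y => g.riemann X Y Z x) x where
  smul {f Y} hf hY := by
    rw [g.riemann_antisymm hX (SmoothField.smul hf hY) hZ, g.riemann_antisymm hX hY hZ,
      (g.riemann_tensorial_left hX hZ).smul hf hY, smul_neg]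
  add {Y Y'} hY hY' := by
    rw [g.riemann_antisymm hX (hY.add hY') hZ, g.riemann_antisymm hX hY hZ,
      g.riemann_antisymm hX hY' hZ, (g.riemann_tensorial_left hX hZ).add hY hY', neg_add]

/-- Second derivatives of `f` appear in this slot; their commutator cancels the derivative along the
bracket, by `dirDeriv_bracket`. -/
theorem riemann_tensorial_right (hX : SmoothField X x) (hY : SmoothField Y x) :
    IsTensorialAt (fun Z => g.riemann X Y Z x) x where
  smul {f Z} hf hZ := by
    have step (A B : VField F M) (hA : SmoothField A x) (hB : SmoothField B x) :
        g.nabla A (g.nabla B (f • Z)) x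
          = dirDeriv A (dirDeriv B f) x • Z x + dirDeriv B f x • g.nabla A Z x
            + (dirDeriv A f x • g.nabla B Z x + f x • g.nabla A (g.nabla B Z) x) := by
      have e : g.nabla B (f • Z) =ᶠ[𝓝 x] dirDeriv B f • Z + f • g.nabla B Z := by
        filter_upwards [hf.eventually, hB.eventually, hZ.eventually] with y h1 h2 h3
        exact g.nabla_smul_right h1 h2 h3
      have hBf := hf.dirDeriv hB
      have hBZ := hB.nabla g hZ
      rw [g.nabla_congr_right e,
        g.nabla_add_right hA (SmoothField.smul hBf hZ) (SmoothField.smul hf hBZ),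
        g.nabla_smul_right hBf hA hZ, g.nabla_smul_right hf hA hBZ]
    simp only [riemann]
    rw [step X Y hX hY, step Y X hY hX, g.nabla_smul_right hf (hX.mlieBracket hY) hZ,
      dirDeriv_bracket hX hY hf]
    module
  add {Z Z'} hZ hZ' := by
    have step (A B : VField F M) (hA : SmoothField A x) (hB : SmoothField B x) :
        g.nabla A (g.nabla B (Z + Z')) x
          = g.nabla A (g.nabla B Z) x + g.nabla A (g.nabla B Z') x := by
      have e : g.nabla B (Z + Z') =ᶠ[𝓝 x] g.nabla B Z + g.nabla B Z' := by
        filter_upwards [hB.eventually, hZ.eventually, hZ'.eventually] with y h1 h2 h3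
        exact g.nabla_add_right h1 h2 h3
      rw [g.nabla_congr_right e,
        g.nabla_add_right hA (hB.nabla g hZ) (hB.nabla g hZ')]
    simp only [riemann]
    rw [step X Y hX hY, step Y X hY hX, g.nabla_add_right (hX.mlieBracket hY) hZ hZ']
    abel

/-- The first Bianchi identity. -/
theorem riemann_bianchi (hX : SmoothField X x) (hY : SmoothField Y x) (hZ : SmoothField Z x) :
    g.riemann X Y Z x + g.riemann Y Z X x + g.riemann Z X Y x = 0 := by
  -- Vanishing torsion, used twice, turns each group of terms of the cyclic sum into a double
  -- bracket; the Jacobi identity concludes.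
  have step {A B C : VField F M} (hA : SmoothField A x) (hB : SmoothField B x)
      (hC : SmoothField C x) :
      g.nabla A (g.nabla B C) x - g.nabla A (g.nabla C B) x - g.nabla ⁅B, C⁆ₘ A x
        = ⁅A, ⁅B, C⁆ₘ⁆ₘ x := by
    have e : g.nabla B C =ᶠ[𝓝 x] g.nabla C B + ⁅B, C⁆ₘ := by
      filter_upwards [hB.eventually, hC.eventually] with y h1 h2
      rw [Pi.add_apply, ← g.nabla_torsion_free h1 h2]
      abel
    have hBC := hB.mlieBracket hC
    rw [g.nabla_congr_right e, g.nabla_add_right hA (hC.nabla g hB) hBC,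
      ← g.nabla_torsion_free hA hBC]
    abel
  have h1 := step hX hY hZ
  have h2 := step hY hZ hX
  have h3 := step hZ hX hY
  have h4 := jacobi hX hY hZ
  have h5 : ⁅⁅X, Y⁆ₘ, Z⁆ₘ x = - ⁅Z, ⁅X, Y⁆ₘ⁆ₘ x := mlieBracket_swap_apply
  have h6 : ⁅Y, ⁅X, Z⁆ₘ⁆ₘ x = - ⁅Y, ⁅Z, X⁆ₘ⁆ₘ x := by
    have h := bracket_smul_right (X := Y) (SmoothFun.const (-1)) (hZ.mlieBracket hX)
    have e : ((fun _ => (-1 : ℝ)) : M → ℝ) • ⁅Z, X⁆ₘ = ⁅X, Z⁆ₘ := by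
      rw [mlieBracket_swap (V := X)]
      funext y
      simp
    rw [e, dirDeriv_const] at h
    simpa using h
  rw [h5, h6, ← h1, ← h2, ← h3] at h4
  have h7 := sub_eq_zero.2 h4
  simp only [riemann]
  rw [← h7]
  abel

/-- The curvature operators are skew-adjoint. -/
theorem riemann_skew (hX : SmoothField X x) (hY : SmoothField Y x) (hZ : SmoothField Z x)
    (hZ' : SmoothField Z' x) :
    g.toCov2 x (g.riemann X Y Z x) (Z' x) = - g.toCov2 x (Z x) (g.riemann X Y Z' x) := by
  -- Differentiate `g(Z, Z')` twice by metric compatibility; the mixed terms are symmetric in `A`,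
  -- `B` and drop out of the commutator.
  have step {A B : VField F M} (hA : SmoothField A x) (hB : SmoothField B x) :
      dirDeriv A (dirDeriv B (fun y => g.toCov2 y (Z y) (Z' y))) x
        = g.toCov2 x (g.nabla A (g.nabla B Z) x) (Z' x)
          + g.toCov2 x (g.nabla B Z x) (g.nabla A Z' x)
          + (g.toCov2 x (g.nabla A Z x) (g.nabla B Z' x)
          + g.toCov2 x (Z x) (g.nabla A (g.nabla B Z') x)) := by
    have e : dirDeriv B (fun y => g.toCov2 y (Z y) (Z' y)) =ᶠ[𝓝 x]
        fun y => g.toCov2 y (g.nabla B Z y) (Z' y) + g.toCov2 y (Z y) (g.nabla B Z' y) := by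
      filter_upwards [hB.eventually, hZ.eventually, hZ'.eventually] with y h1 h2 h3
      exact g.nabla_metric h1 h2 h3
    have hBZ := hB.nabla g hZ
    have hBZ' := hB.nabla g hZ'
    rw [dirDeriv_congr e, dirDeriv_add (g.smoothFun_toCov2 hBZ hZ') (g.smoothFun_toCov2 hZ hBZ'),
      g.nabla_metric hA hBZ hZ', g.nabla_metric hA hZ hBZ']
  have h1 := dirDeriv_bracket hX hY (g.smoothFun_toCov2 hZ hZ')
  rw [step hX hY, step hY hX, g.nabla_metric (hX.mlieBracket hY) hZ hZ'] at h1
  simp only [riemann, toCov2_sub_left, toCov2_sub_right]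
  linarith

/-- The Ricci tensor as a trace, evaluated on arbitrary fields. -/
theorem ricci_eq_trace (hY : SmoothField Y x) (hZ : SmoothField Z x) :
    g.ricci x (Y x) (Z x)
      = LinearMap.trace ℝ _ (g.riemann_tensorial_left hY hZ).toLinearMap := by
  rw [← sum_coord_eq_trace (Module.finBasis ℝ (TangentSpace 𝓘(ℝ, F) x))]
  refine Finset.sum_congr rfl fun i _ => ?_
  have hX := SmoothField.ext (Module.finBasis ℝ (TangentSpace 𝓘(ℝ, F) x) i)
  rw [IsTensorialAt.toLinearMap_ext,
    ← (g.riemann_tensorial_mid hX (SmoothField.ext (Z x))).eq_ext hY,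
    ← (g.riemann_tensorial_right hX hY).eq_ext hZ]

theorem ricci_tensorial_left (hZ : SmoothField Z x) :
    IsTensorialAt (fun Y => g.ricci x (Y x) (Z x)) x where
  smul {f Y} hf hY := by
    rw [g.ricci_eq_trace (SmoothField.smul hf hY) hZ, g.ricci_eq_trace hY hZ, ← map_smul]
    congr 1
    ext u
    exact (g.riemann_tensorial_mid (SmoothField.ext u) hZ).smul hf hY
  add {Y Y'} hY hY' := by
    rw [g.ricci_eq_trace (hY.add hY') hZ, g.ricci_eq_trace hY hZ, g.ricci_eq_trace hY' hZ,
      ← map_add]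
    congr 1
    ext u
    exact (g.riemann_tensorial_mid (SmoothField.ext u) hZ).add hY hY'

/-- By the first Bianchi identity the antisymmetric part is, up to a factor, the trace of the
skew-adjoint operator `R(v, w)`, which is zero in any signature. -/
theorem ricci_symm (v w : TangentSpace 𝓘(ℝ, F) x) : g.ricci x v w = g.ricci x w v := by
  have hv := SmoothField.ext v
  have hw := SmoothField.ext w
  have h1 := g.ricci_eq_trace hv hw
  have h2 := g.ricci_eq_trace hw hv
  rw [ext_self, ext_self] at h1 h2
  have h0 : LinearMap.trace ℝ _ (g.riemann_tensorial_right hv hw).toLinearMap = 0 := by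
    refine trace_eq_zero_of_skew (g.nondegenerate x) fun u u' => ?_
    have := g.riemann_skew hv hw (SmoothField.ext u) (SmoothField.ext u')
    rwa [ext_self, ext_self] at this
  rw [h1, h2, ← sub_eq_zero, ← map_sub, ← neg_eq_zero, ← map_neg, ← h0]
  congr 1
  ext u
  have hu := SmoothField.ext u
  have h3 := g.riemann_bianchi hu hv hw
  have h4 := g.riemann_antisymm hw hu hv
  rw [h4] at h3
  change -(g.riemann (HypersurfaceData.ext u) _ _ x - g.riemann (HypersurfaceData.ext u) _ _ x)
    = g.riemann _ _ (HypersurfaceData.ext u) x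
  rw [eq_comm, ← sub_eq_zero, ← h3]
  abel

/-- The trace does not depend on the basis, so the pointwise bases of the definition can be traded
for a smooth local frame. -/
theorem smoothFun_ricci (hY : SmoothField Y x) (hZ : SmoothField Z x) :
    SmoothFun F (fun y => g.ricci y (Y y) (Z y)) x := by
  set t := trivializationAt F (TangentSpace 𝓘(ℝ, F)) x
  have : IsManifold 𝓘(ℝ, F) 1 M := IsManifold.of_le (n := ∞) (by simp)
  have hs (i) : SmoothField (frame F x i) x := smoothField_frame x i
  refine (SmoothFun.sum (s := Finset.univ) fun i _ =>
    smoothFun_frameCoeff ((hs i).riemann g hY hZ) i).congr ?_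
  filter_upwards [t.open_baseSet.mem_nhds (FiberBundle.mem_baseSet_trivializationAt' x),
    hY.eventually, hZ.eventually, eventually_all.2 fun j => (hs j).eventually] with y hy hYy hZy hsy
  rw [g.ricci_eq_trace hYy hZy, ← sum_coord_eq_trace (t.basisAt (Module.finBasis ℝ F) hy)]
  refine Finset.sum_congr rfl fun i _ => ?_
  have e : t.basisAt (Module.finBasis ℝ F) hy i = frame F x i y :=
    (t.localFrame_apply_of_mem_baseSet _ hy).symm
  rw [e, IsTensorialAt.toLinearMap_apply _ (hsy i), frameCoeff,
    t.localFrameCoeff_apply_of_mem_baseSet (Module.finBasis ℝ F) hy]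
  rfl

end SemiRiemannianMetric

end Curvature

/-! ### Iterated Lie derivatives along a rescaled field. -/

section LieDerivative

variable {E : Type*} [NormedAddCommGroup E] [NormedSpace ℝ E]
  {N : Type*} [TopologicalSpace N] [ChartedSpace E N] [IsManifold 𝓘(ℝ, E) ∞ N]

local notation "⁅" X ", " Y "⁆ₘ" => mlieBracket 𝓘(ℝ, E) X Y

/-- `T` is a smooth bilinear covariant two-tensor on the open set `U`. -/
structure IsSmoothTensorOn (T : Cov2 E N) (U : Set N) : Prop where
  isOpen : IsOpen U
  add_left : ∀ x ∈ U, ∀ v v' w, T x (v + v') w = T x v w + T x v' w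
  smul_left : ∀ x ∈ U, ∀ (c : ℝ) v w, T x (c • v) w = c * T x v w
  add_right : ∀ x ∈ U, ∀ v w w', T x v (w + w') = T x v w + T x v w'
  smul_right : ∀ x ∈ U, ∀ (c : ℝ) v w, T x v (c • w) = c * T x v w
  smooth : ∀ x ∈ U, ∀ X Y : VField E N, SmoothField X x → SmoothField Y x →
    SmoothFun E (fun y => T y (X y) (Y y)) x

variable {T S : Cov2 E N} {U : Set N} {X V V' W : VField E N} {f z : N → ℝ} {x : N}

theorem lieD_congr (h : ∀ᶠ y in 𝓝 x, T y = S y) : lieD X T x = lieD X S x := by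
  funext v w
  have e : (fun y => T y (ext v y) (ext w y)) =ᶠ[𝓝 x] fun y => S y (ext v y) (ext w y) := by
    filter_upwards [h] with y hy
    rw [hy]
  rw [lieD, lieD, dirDeriv_congr e, h.self_of_nhds]

theorem iterate_lieD_symm (hT : ∀ x v w, T x v w = T x w v) (k : ℕ) (x : N)
    (v w : TangentSpace 𝓘(ℝ, E) x) : (lieD X)^[k] T x v w = (lieD X)^[k] T x w v := by
  induction k generalizing x with
  | zero => exact hT x v w
  | succ k ih =>
    simp only [Function.iterate_succ_apply', lieD]
    rw [show (fun y => (lieD X)^[k] T y (ext v y) (ext w y))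
      = fun y => (lieD X)^[k] T y (ext w y) (ext v y) from funext fun y => ih y _ _,
      ih x _ w, ih x v]
    ring

namespace IsSmoothTensorOn

theorem zero_left (hT : IsSmoothTensorOn T U) (hx : x ∈ U) (w : TangentSpace 𝓘(ℝ, E) x) :
    T x 0 w = 0 := by
  simpa using hT.smul_left x hx 0 0 w

theorem zero_right (hT : IsSmoothTensorOn T U) (hx : x ∈ U) (v : TangentSpace 𝓘(ℝ, E) x) :
    T x v 0 = 0 := by
  simpa using hT.smul_right x hx 0 v 0

theorem eventually_mem (hT : IsSmoothTensorOn T U) (hx : x ∈ U) : ∀ᶠ y in 𝓝 x, y ∈ U :=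
  hT.isOpen.mem_nhds hx

/-- The tensor at a point, as a bilinear form. -/
def toBilin (hT : IsSmoothTensorOn T U) (hx : x ∈ U) :
    LinearMap.BilinForm ℝ (TangentSpace 𝓘(ℝ, E) x) :=
  LinearMap.mk₂ ℝ (T x) (hT.add_left x hx) (hT.smul_left x hx) (hT.add_right x hx)
    (hT.smul_right x hx)

protected theorem mul (hT : IsSmoothTensorOn T U) (hf : ∀ x ∈ U, SmoothFun E f x) :
    IsSmoothTensorOn (fun y v w => f y * T y v w) U where
  isOpen := hT.isOpen
  add_left x hx v v' w := by rw [hT.add_left x hx, mul_add]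
  smul_left x hx c v w := by rw [hT.smul_left x hx, mul_left_comm]
  add_right x hx v w w' := by rw [hT.add_right x hx, mul_add]
  smul_right x hx c v w := by rw [hT.smul_right x hx, mul_left_comm]
  smooth x hx X Y hX hY := (hf x hx).mul (hT.smooth x hx X Y hX hY)

/-- The Lie derivative along `X` of `f T`. -/
theorem lieD_mul (hT : IsSmoothTensorOn T U) (hx : x ∈ U)
    (hf : SmoothFun E f x) (v w : TangentSpace 𝓘(ℝ, E) x) :
    HypersurfaceData.lieD X (fun y v w => f y * T y v w) x v w
      = f x * HypersurfaceData.lieD X T x v w + dirDeriv X f x * T x v w := by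
  simp only [HypersurfaceData.lieD,
    dirDeriv_mul hf (hT.smooth x hx _ _ (SmoothField.ext v) (SmoothField.ext w)), ext_self]
  ring

variable [FiniteDimensional ℝ E]

theorem lieD_tensorial_left (hT : IsSmoothTensorOn T U) (hx : x ∈ U)
    (hW : SmoothField W x) :
    IsTensorialAt (fun V => dirDeriv X (fun y => T y (V y) (W y)) x
      - T x (⁅X, V⁆ₘ x) (W x) - T x (V x) (⁅X, W⁆ₘ x)) x where
  smul {f V} hf hV := by
    have e : (fun y => T y ((f • V) y) (W y)) =ᶠ[𝓝 x] fun y => f y * T y (V y) (W y) := by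
      filter_upwards [hT.eventually_mem hx] with y hy
      exact hT.smul_left y hy _ _ _
    rw [dirDeriv_congr e, dirDeriv_mul hf (hT.smooth x hx _ _ hV hW), bracket_smul_right hf hV,
      hT.add_left x hx, hT.smul_left x hx, hT.smul_left x hx, Pi.smul_apply', hT.smul_left x hx,
      smul_eq_mul]
    ring
  add {V V'} hV hV' := by
    have e : (fun y => T y ((V + V') y) (W y))
        =ᶠ[𝓝 x] fun y => T y (V y) (W y) + T y (V' y) (W y) := by
      filter_upwards [hT.eventually_mem hx] with y hy
      exact hT.add_left y hy _ _ _
    rw [dirDeriv_congr e, dirDeriv_add (hT.smooth x hx _ _ hV hW) (hT.smooth x hx _ _ hV' hW),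
      bracket_add_right hV hV', hT.add_left x hx, Pi.add_apply, hT.add_left x hx]
    ring

theorem lieD_tensorial_right (hT : IsSmoothTensorOn T U) (hx : x ∈ U)
    (hV : SmoothField V x) :
    IsTensorialAt (fun W => dirDeriv X (fun y => T y (V y) (W y)) x
      - T x (⁅X, V⁆ₘ x) (W x) - T x (V x) (⁅X, W⁆ₘ x)) x where
  smul {f W} hf hW := by
    have e : (fun y => T y (V y) ((f • W) y)) =ᶠ[𝓝 x] fun y => f y * T y (V y) (W y) := by
      filter_upwards [hT.eventually_mem hx] with y hy
      exact hT.smul_right y hy _ _ _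
    rw [dirDeriv_congr e, dirDeriv_mul hf (hT.smooth x hx _ _ hV hW), bracket_smul_right hf hW,
      hT.add_right x hx, hT.smul_right x hx, hT.smul_right x hx, Pi.smul_apply',
      hT.smul_right x hx, smul_eq_mul]
    ring
  add {W W'} hW hW' := by
    have e : (fun y => T y (V y) ((W + W') y))
        =ᶠ[𝓝 x] fun y => T y (V y) (W y) + T y (V y) (W' y) := by
      filter_upwards [hT.eventually_mem hx] with y hy
      exact hT.add_right y hy _ _ _
    rw [dirDeriv_congr e, dirDeriv_add (hT.smooth x hx _ _ hV hW) (hT.smooth x hx _ _ hV hW'),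
      bracket_add_right hW hW', hT.add_right x hx, Pi.add_apply, hT.add_right x hx]
    ring

/-- The formula defining the Lie derivative, for arbitrary fields. -/
theorem lieD_apply (hT : IsSmoothTensorOn T U) (hx : x ∈ U) (hV : SmoothField V x)
    (hW : SmoothField W x) :
    lieD X T x (V x) (W x) = dirDeriv X (fun y => T y (V y) (W y)) x
      - T x (⁅X, V⁆ₘ x) (W x) - T x (V x) (⁅X, W⁆ₘ x) := by
  rw [(hT.lieD_tensorial_left (X := X) hx hW).eq_ext hV,
    (hT.lieD_tensorial_right (X := X) hx (SmoothField.ext (V x))).eq_ext hW]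
  simp only [lieD, ext_self]

protected theorem lieD (hT : IsSmoothTensorOn T U) (hX : ∀ x ∈ U, SmoothField X x) :
    IsSmoothTensorOn (lieD X T) U where
  isOpen := hT.isOpen
  add_left x hx v v' w := by
    simpa [HypersurfaceData.lieD] using
      (hT.lieD_tensorial_left (X := X) hx (SmoothField.ext w)).ext_add v v'
  smul_left x hx c v w := by
    simpa [HypersurfaceData.lieD] using
      (hT.lieD_tensorial_left (X := X) hx (SmoothField.ext w)).ext_smul c v
  add_right x hx v w w' := by
    simpa [HypersurfaceData.lieD] using
      (hT.lieD_tensorial_right (X := X) hx (SmoothField.ext v)).ext_add w w'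
  smul_right x hx c v w := by
    simpa [HypersurfaceData.lieD] using
      (hT.lieD_tensorial_right (X := X) hx (SmoothField.ext v)).ext_smul c w
  smooth x hx V W hV hW := by
    refine ((((hT.smooth x hx V W hV hW).dirDeriv (hX x hx)).sub
      (hT.smooth x hx _ _ ((hX x hx).mlieBracket hV) hW)).sub
      (hT.smooth x hx _ _ hV ((hX x hx).mlieBracket hW))).congr ?_
    filter_upwards [hT.eventually_mem hx, hV.eventually, hW.eventually] with y hy hVy hWy
    exact hT.lieD_apply hy hVy hWy

theorem iterate_lieD (hT : IsSmoothTensorOn T U) (hX : ∀ x ∈ U, SmoothField X x) (k : ℕ) :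
    IsSmoothTensorOn ((HypersurfaceData.lieD X)^[k] T) U := by
  induction k with
  | zero => exact hT
  | succ k ih =>
    rw [Function.iterate_succ_apply']
    exact ih.lieD hX

end IsSmoothTensorOn

variable [FiniteDimensional ℝ E]

/-- The Lie derivative along `f X`. -/
theorem IsSmoothTensorOn.lieD_smul_field (hT : IsSmoothTensorOn T U) (hx : x ∈ U)
    (hf : SmoothFun E f x) (hX : SmoothField X x) (v w : TangentSpace 𝓘(ℝ, E) x) :
    HypersurfaceData.lieD (f • X) T x v w = f x * HypersurfaceData.lieD X T x v w
      + mvfderiv 𝓘(ℝ, E) f x v * T x (X x) w + mvfderiv 𝓘(ℝ, E) f x w * T x v (X x) := by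
  simp only [HypersurfaceData.lieD, dirDeriv_smul_field, bracket_smul_left hf hX,
    hT.add_left x hx, hT.add_right x hx, hT.smul_left x hx, hT.smul_right x hx,
    dirDeriv_eq_mvfderiv (ext v), dirDeriv_eq_mvfderiv (ext w), ext_self]
  ring

/-- Since `[X, X] = 0`, contraction with `X` commutes with `L_X`. -/
theorem IsSmoothTensorOn.lieD_self_left (hT : IsSmoothTensorOn T U) (hx : x ∈ U)
    (hX : SmoothField X x) (hV : SmoothField V x) :
    HypersurfaceData.lieD X T x (X x) (V x)
      = dirDeriv X (fun y => T y (X y) (V y)) x - T x (X x) (⁅X, V⁆ₘ x) := by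
  rw [hT.lieD_apply hx hX hV, mlieBracket_self, Pi.zero_apply, hT.zero_left hx, sub_zero]

theorem IsSmoothTensorOn.lieD_self_right (hT : IsSmoothTensorOn T U) (hx : x ∈ U)
    (hX : SmoothField X x) (hV : SmoothField V x) :
    HypersurfaceData.lieD X T x (V x) (X x)
      = dirDeriv X (fun y => T y (V y) (X y)) x - T x (⁅X, V⁆ₘ x) (X x) := by
  rw [hT.lieD_apply hx hV hX, mlieBracket_self, Pi.zero_apply, hT.zero_right hx, sub_zero]

theorem IsSmoothTensorOn.lieD_self_self (hT : IsSmoothTensorOn T U) (hx : x ∈ U)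
    (hX : SmoothField X x) :
    HypersurfaceData.lieD X T x (X x) (X x) = dirDeriv X (fun y => T y (X y) (X y)) x := by
  rw [hT.lieD_self_left hx hX hX, mlieBracket_self, Pi.zero_apply, hT.zero_right hx, sub_zero]

/-- The differential of a function that is constant along `X` is invariant under `X`. -/
theorem dirDeriv_dirDeriv_of_invariant (hX : SmoothField X x) (hV : SmoothField V x)
    (hz : SmoothFun E z x) (hXz : ∀ᶠ y in 𝓝 x, dirDeriv X z y = 0) :
    dirDeriv X (dirDeriv V z) x = mvfderiv 𝓘(ℝ, E) z x (⁅X, V⁆ₘ x) := by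
  have h := dirDeriv_bracket hX hV hz
  rw [dirDeriv_congr (f := dirDeriv X z) (h := fun _ => 0) hXz, dirDeriv_const, sub_zero] at h
  exact h.symm

/-- The Lie derivative of a tensor `a A + b (dz ⊗ i_X B + i_X B ⊗ dz) + c dz ⊗ dz`, where `a`, `b`
and `z` are constant along `X`. -/
theorem lieD_combination {A B : Cov2 E N} {a b c : N → ℝ} (hA : IsSmoothTensorOn A U)
    (hB : IsSmoothTensorOn B U) (hx : x ∈ U) (hX : SmoothField X x)
    (hz : SmoothFun E z x) (hXz : ∀ᶠ y in 𝓝 x, dirDeriv X z y = 0)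
    (ha : SmoothFun E a x) (hb : SmoothFun E b x) (hc : SmoothFun E c x)
    (hXa : dirDeriv X a x = 0) (hXb : dirDeriv X b x = 0) (v w : TangentSpace 𝓘(ℝ, E) x) :
    lieD X (fun y v w => a y * A y v w
        + b y * (mvfderiv 𝓘(ℝ, E) z y v * B y (X y) w + mvfderiv 𝓘(ℝ, E) z y w * B y v (X y))
        + c y * (mvfderiv 𝓘(ℝ, E) z y v * mvfderiv 𝓘(ℝ, E) z y w)) x v w
      = a x * lieD X A x v w
        + b x * (mvfderiv 𝓘(ℝ, E) z x v * lieD X B x (X x) w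
          + mvfderiv 𝓘(ℝ, E) z x w * lieD X B x v (X x))
        + dirDeriv X c x * (mvfderiv 𝓘(ℝ, E) z x v * mvfderiv 𝓘(ℝ, E) z x w) := by
  have hv := SmoothField.ext v
  have hw := SmoothField.ext w
  have hvz := hz.dirDeriv hv
  have hwz := hz.dirDeriv hw
  have hAvw := hA.smooth x hx _ _ hv hw
  have hBw := hB.smooth x hx _ _ hX hw
  have hBv := hB.smooth x hx _ _ hv hX
  -- `h1` and `h2` move `L_X` through the contraction with `X`; `h3` and `h4` say that `L_X dz = 0`.
  have h1 := hB.lieD_self_left hx hX hw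
  have h2 := hB.lieD_self_right hx hX hv
  have h3 := dirDeriv_dirDeriv_of_invariant hX hv hz hXz
  have h4 := dirDeriv_dirDeriv_of_invariant hX hw hz hXz
  rw [ext_self] at h1 h2
  rw [h1, h2, lieD, lieD]
  have e (Z : VField E N) (y : N) : mvfderiv 𝓘(ℝ, E) z y (Z y) = dirDeriv Z z y := rfl
  simp only [e]
  rw [dirDeriv_add ((ha.mul hAvw).add (hb.mul ((hvz.mul hBw).add (hwz.mul hBv))))
      (hc.mul (hvz.mul hwz)), dirDeriv_add (ha.mul hAvw) (hb.mul ((hvz.mul hBw).add (hwz.mul hBv))),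
    dirDeriv_mul ha hAvw, dirDeriv_mul hb ((hvz.mul hBw).add (hwz.mul hBv)),
    dirDeriv_add (hvz.mul hBw) (hwz.mul hBv), dirDeriv_mul hvz hBw, dirDeriv_mul hwz hBv,
    dirDeriv_mul hc (hvz.mul hwz), dirDeriv_mul hvz hwz, hXa, hXb, h3, h4]
  have e1 : dirDeriv (ext v) z x = mvfderiv 𝓘(ℝ, E) z x v := by
    rw [dirDeriv_eq_mvfderiv, ext_self]
  have e2 : dirDeriv (ext w) z x = mvfderiv 𝓘(ℝ, E) z x w := by
    rw [dirDeriv_eq_mvfderiv, ext_self]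
  simp only [e1, e2, ext_self]
  simp only [← e]
  ring

/-- Iterated Lie derivatives along `z X`, for a function `z` that is constant along `X`. -/
theorem iterate_lieD_smul (hT : IsSmoothTensorOn T U) (hX : ∀ x ∈ U, SmoothField X x)
    (hz : ∀ x ∈ U, SmoothFun E z x) (hXz : ∀ x ∈ U, dirDeriv X z x = 0) (m : ℕ) (hx : x ∈ U)
    (v w : TangentSpace 𝓘(ℝ, E) x) :
    (lieD (z • X))^[m] T x v w
      = z x ^ m * (lieD X)^[m] T x v w
        + m * z x ^ (m - 1) * (mvfderiv 𝓘(ℝ, E) z x v * (lieD X)^[m - 1] T x (X x) w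
          + mvfderiv 𝓘(ℝ, E) z x w * (lieD X)^[m - 1] T x v (X x))
        + m * (m - 1) * z x ^ (m - 2) * (lieD X)^[m - 2] T x (X x) (X x)
          * (mvfderiv 𝓘(ℝ, E) z x v * mvfderiv 𝓘(ℝ, E) z x w) := by
  have hzX : ∀ x ∈ U, SmoothField (z • X) x := fun x hx => SmoothField.smul (hz x hx) (hX x hx)
  induction m generalizing x with
  | zero => simp
  | succ m ih =>
    have hA := hT.iterate_lieD hX m
    have hB := hT.iterate_lieD hX (m - 1)
    have hC := hT.iterate_lieD hX (m - 2)
    have hXX := hC.smooth x hx _ _ (hX x hx) (hX x hx)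
    have hzx := hz x hx
    have hmem := hT.eventually_mem hx
    have hc := ((SmoothFun.const ((m : ℝ) * (m - 1))).mul (hzx.pow (m - 2))).mul hXX
    have hb := (SmoothFun.const (m : ℝ)).mul (hzx.pow (m - 1))
    have hzz (k : ℕ) := dirDeriv_pow_eq_zero hzx (hXz x hx) k
    have hXb : dirDeriv X (fun y => (m : ℝ) * z y ^ (m - 1)) x = 0 := by
      rw [dirDeriv_mul (SmoothFun.const _) (hzx.pow _), dirDeriv_const, hzz]
      ring
    have hXc : dirDeriv X (fun y => (m : ℝ) * (m - 1) * z y ^ (m - 2)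
        * (lieD X)^[m - 2] T y (X y) (X y)) x
        = m * (m - 1) * z x ^ (m - 2) * lieD X ((lieD X)^[m - 2] T) x (X x) (X x) := by
      rw [dirDeriv_mul ((SmoothFun.const ((m : ℝ) * (m - 1))).mul (hzx.pow (m - 2))) hXX,
        dirDeriv_mul (SmoothFun.const _) (hzx.pow _), dirDeriv_const, hzz,
        hC.lieD_self_self hx (hX x hx)]
      ring
    -- The induction hypothesis is a combination with `a = z^m`, `b = m z^(m-1)`, and `c` containing
    -- `(L_X^(m-2) T)(X, X)`. Only `c` varies along `X`, and its derivative raises the order by one.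
    have key := lieD_combination hA hB hx (hX x hx) hzx (hmem.mono hXz) (hzx.pow m) hb hc
      (hzz m) hXb v w
    rw [hXc] at key
    have hcongr := lieD_congr (X := X) (hmem.mono fun y hy => funext₂ fun v w => ih hy v w)
    -- Passing from `L_X` to `L_{zX}` adds the contractions of the induction hypothesis with `X`. As
    -- `dz(X) = 0`, they contribute `z^m` to the middle coefficient and `2m z^(m-1)` to the last,
    -- where `m(m-1) + 2m = (m+1)m`.
    have hdz : mvfderiv 𝓘(ℝ, E) z x (X x) = 0 := hXz x hx
    rw [Function.iterate_succ_apply', (hT.iterate_lieD hzX m).lieD_smul_field hx hzx (hX x hx),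
      hcongr, key, ih hx, ih hx, hdz]
    simp only [← Function.iterate_succ_apply' (lieD X)]
    -- Truncated subtraction spoils the powers of `z` for `m = 0, 1`, exactly where their
    -- coefficients vanish.
    rcases m with _ | _ | m
    · simp
      ring
    · simp
      ring
    · simp only [Nat.add_sub_cancel, Nat.succ_eq_add_one, pow_succ,
        show m + 1 + 1 - 2 = m by omega, show m + 1 + 1 + 1 - 2 = m + 1 by omega,
        show m + 1 + 1 - 1 = m + 1 by omega]
      push_cast
      ring

end LieDerivative

/-! ### Smoothness of pulled back functions and tensors. -/

section Pullback

variable {E : Type*} [NormedAddCommGroup E] [NormedSpace ℝ E]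
  {H : Type*} [TopologicalSpace H] [ChartedSpace E H]
  {F : Type*} [NormedAddCommGroup F] [NormedSpace ℝ F]
  {M : Type*} [TopologicalSpace M] [ChartedSpace F M]
  {Φ : H → M} {p : H}

theorem SmoothFun.comp {f : M → ℝ} (hf : SmoothFun F f (Φ p))
    (hΦ : ContMDiff 𝓘(ℝ, E) 𝓘(ℝ, F) ∞ Φ) : SmoothFun E (f ∘ Φ) p := by
  filter_upwards [hΦ.continuous.continuousAt.eventually hf] with q hq
  exact hq.comp q hΦ.contMDiffAt

theorem mvfderiv_comp_smooth {f : M → ℝ} (hf : SmoothFun F f (Φ p))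
    (hΦ : ContMDiff 𝓘(ℝ, E) 𝓘(ℝ, F) ∞ Φ) (v : TangentSpace 𝓘(ℝ, E) p) :
    mvfderiv 𝓘(ℝ, E) (f ∘ Φ) p v
      = mvfderiv 𝓘(ℝ, F) f (Φ p) (mfderiv 𝓘(ℝ, E) 𝓘(ℝ, F) Φ p v) :=
  mvfderiv_comp_apply p hf.mdiff (hΦ.contMDiffAt.mdifferentiableAt (by simp)) v

variable [FiniteDimensional ℝ F] [IsManifold 𝓘(ℝ, E) ∞ H] [IsManifold 𝓘(ℝ, F) ∞ M]

theorem IsSmoothTensorOn.pullback2 {T : Cov2 F M} {U : Set M} (hT : IsSmoothTensorOn T U)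
    (hΦ : ContMDiff 𝓘(ℝ, E) 𝓘(ℝ, F) ∞ Φ) (hU : ∀ p, Φ p ∈ U) :
    IsSmoothTensorOn (HypersurfaceData.pullback2 (E := E) Φ T) Set.univ where
  isOpen := isOpen_univ
  add_left p _ v v' w := by
    simp [HypersurfaceData.pullback2, hT.add_left (Φ p) (hU p)]
  smul_left p _ c v w := by
    simp [HypersurfaceData.pullback2, hT.smul_left (Φ p) (hU p)]
  add_right p _ v w w' := by
    simp [HypersurfaceData.pullback2, hT.add_right (Φ p) (hU p)]
  smul_right p _ c v w := by
    simp [HypersurfaceData.pullback2, hT.smul_right (Φ p) (hU p)]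
  smooth p _ X Y hX hY := by
    set t := trivializationAt F (TangentSpace 𝓘(ℝ, F)) (Φ p)
    set b := Module.finBasis ℝ F
    -- The pushforward of `Z` is only a field along `Φ`, not a field on `M`. Its components in a
    -- frame of `M` are smooth on `H`, and smoothness of `T` is then needed on frame fields only.
    let c (Z : VField E H) (i : Fin (Module.finrank ℝ F)) (q : H) : ℝ :=
      b.repr (t ⟨Φ q, mfderiv 𝓘(ℝ, E) 𝓘(ℝ, F) Φ q (Z q)⟩).2 i
    have hbase : ∀ᶠ q in 𝓝 p, Φ q ∈ t.baseSet := hΦ.continuous.continuousAt.eventually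
      (t.open_baseSet.mem_nhds (FiberBundle.mem_baseSet_trivializationAt' (Φ p)))
    have hc (Z : VField E H) (hZ : SmoothField Z p) (i) : SmoothFun E (c Z i) p := by
      filter_upwards [hZ.eventually, hbase] with q hq hqb
      have h1 := SmoothField.contMDiffAt_mfderiv hΦ.contMDiffAt hq
      have h2 := ((Bundle.Trivialization.contMDiffOn (IB := 𝓘(ℝ, F)) (n := ∞) t).contMDiffAt
        (x := ⟨Φ q, mfderiv 𝓘(ℝ, E) 𝓘(ℝ, F) Φ q (Z q)⟩)
        (t.open_source.mem_nhds (t.mem_source.2 hqb))).comp q h1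
      have h3 : ContDiff ℝ ∞ fun u : F => b.coord i u :=
        (LinearMap.toContinuousLinearMap (b.coord i)).contDiff
      exact h3.contMDiff.contMDiffAt.comp q h2.snd
    have hsum {y : M} (hy : y ∈ t.baseSet) (u : TangentSpace 𝓘(ℝ, F) y) :
        u = ∑ i, b.repr (t ⟨y, u⟩).2 i • frame F (Φ p) i y := by
      conv_lhs => rw [← (t.basisAt b hy).sum_repr u]
      refine Finset.sum_congr rfl fun i _ => ?_
      rw [frame, t.localFrame_apply_of_mem_baseSet _ hy]
      simp [Bundle.Trivialization.basisAt, b]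
    refine (SmoothFun.sum (s := Finset.univ) fun i _ => SmoothFun.sum (s := Finset.univ) fun j _ =>
      ((hc X hX i).mul (hc Y hY j)).mul ((hT.smooth (Φ p) (hU p) _ _ (smoothField_frame _ i)
        (smoothField_frame _ j)).comp hΦ)).congr ?_
    filter_upwards [hbase] with q hq
    change (hT.toBilin (hU q)) _ _ = _
    conv_lhs =>
      rw [hsum hq (mfderiv 𝓘(ℝ, E) 𝓘(ℝ, F) Φ q (X q)),
        hsum hq (mfderiv 𝓘(ℝ, E) 𝓘(ℝ, F) Φ q (Y q))]
    simp only [map_sum, map_smul, LinearMap.sum_apply, LinearMap.smul_apply, smul_eq_mul,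
      Finset.mul_sum]
    rw [Finset.sum_comm]
    refine Finset.sum_congr rfl fun i _ => Finset.sum_congr rfl fun j _ => ?_
    rw [mul_left_comm, ← mul_assoc]
    rfl

end Pullback

/-! ### Behaviour of null metric data under rescaling of the rigging. -/

section Rescaling

theorem contract_mul {V : Type*} [AddCommGroup V] [Module ℝ V] [FiniteDimensional ℝ V]
    (P : Module.Dual ℝ V → Module.Dual ℝ V → ℝ) (T : V → V → ℝ) (c : ℝ) :
    contract P (fun v w => c * T v w) = c * contract P T := by
  simp only [contract, Finset.mul_sum]
  exact Finset.sum_congr rfl fun i _ => Finset.sum_congr rfl fun j _ => mul_left_comm _ _ _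

variable {E : Type*} [NormedAddCommGroup E] [NormedSpace ℝ E]
  {H : Type*} [TopologicalSpace H] [ChartedSpace E H] [IsManifold 𝓘(ℝ, E) ∞ H]

namespace MetricData

variable {D D' : MetricData E H} {p : H} {X Y : VField E H} {ζ : H → ℝ}

omit [IsManifold 𝓘(ℝ, E) ∞ H] in
theorem formA_apply (x y : TangentSpace 𝓘(ℝ, E) p × ℝ) :
    D.formA p x y = D.gamma p x.1 y.1 + x.2 * D.ell p y.1 + y.2 * D.ell p x.1
      + x.2 * y.2 * D.ell2 p := rfl

namespace IsNull

theorem smoothFun_gamma [FiniteDimensional ℝ E] (hD : D.IsNull) (hX : SmoothField X p)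
    (hY : SmoothField Y p) : SmoothFun E (fun q => D.gamma q (X q) (Y q)) p := by
  filter_upwards [hX, hY] with q hXq hYq
  have h := ContMDiffAt.clm_bundle_apply₂ (E₃ := Bundle.Trivial H ℝ) (F₃ := ℝ) (b := id)
    (hD.smooth_gamma q) hXq hYq
  rw [Bundle.contMDiffAt_totalSpace] at h
  exact h.2

theorem smoothFun_ell [FiniteDimensional ℝ E] (hD : D.IsNull) (hX : SmoothField X p) :
    SmoothFun E (fun q => D.ell q (X q)) p := by
  filter_upwards [hX] with q hXq
  have h := ContMDiffAt.clm_bundle_apply (E₂ := Bundle.Trivial H ℝ) (F₂ := ℝ) (b := id)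
    (hD.smooth_ell q) hXq
  rw [Bundle.contMDiffAt_totalSpace] at h
  exact h.2

theorem isSmoothTensorOn_gammaCov [FiniteDimensional ℝ E] (hD : D.IsNull) :
    IsSmoothTensorOn D.gammaCov Set.univ where
  isOpen := isOpen_univ
  add_left p _ v v' w := by simp [gammaCov]
  smul_left p _ c v w := by simp [gammaCov]
  add_right p _ v w w' := by simp [gammaCov]
  smul_right p _ c v w := by simp [gammaCov]
  smooth p _ X Y hX hY := hD.smoothFun_gamma hX hY

variable [FiniteDimensional ℝ E]

/-- Here `n⁽²⁾ = 0` enters: raising `(0, 1)` gives `(n, 0)`, whence `γ(n, ·) = 0` and `ℓ(n) = 1`. -/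
theorem formA_n (hD : D.IsNull) (y : TangentSpace 𝓘(ℝ, E) p × ℝ) :
    D.formA p (D.n p, 0) y = y.2 := by
  have h := raise_spec (hD.nondegenerate p) (LinearMap.snd ℝ (TangentSpace 𝓘(ℝ, E) p) ℝ) y
  have h2 : raise (D.formA p) (LinearMap.snd ℝ (TangentSpace 𝓘(ℝ, E) p) ℝ) = (D.n p, 0) :=
    Prod.ext rfl (hD.n2_eq_zero p)
  rwa [h2] at h

theorem gamma_n (hD : D.IsNull) (v : TangentSpace 𝓘(ℝ, E) p) : D.gamma p (D.n p) v = 0 := by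
  simpa [formA_apply] using hD.formA_n (v, 0)

theorem ell_n (hD : D.IsNull) : D.ell p (D.n p) = 1 := by
  simpa [formA_apply] using hD.formA_n (p := p) (0, 1)

/-- Cramer's rule for the matrix of `𝒜` in a frame of `TH × ℝ`. The additional unknown is `n⁽²⁾`,
which is why the last component of `u` is zero. -/
theorem smoothField_n (hD : D.IsNull) : SmoothField D.n p := by
  set t := trivializationAt E (TangentSpace 𝓘(ℝ, E)) p
  have hp := FiberBundle.mem_baseSet_trivializationAt' (F := E) (E := TangentSpace 𝓘(ℝ, E)) p
  have hs (i) : SmoothField (frame E p i) p := smoothField_frame p i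
  refine SmoothField.of_frameCoeff fun i => ?_
  have hell2 : SmoothFun E D.ell2 p := Eventually.of_forall fun q => hD.smooth_ell2 q
  refine SmoothFun.of_linear_system (ι := Fin (Module.finrank ℝ E) ⊕ Unit)
    (G := fun q => Matrix.of fun k l =>
      D.formA q (Sum.elim (fun i => (frame E p i q, (0 : ℝ))) (fun _ => (0, 1)) k)
        (Sum.elim (fun i => (frame E p i q, (0 : ℝ))) (fun _ => (0, 1)) l))
    (u := Sum.elim (fun i => frameCoeff p i D.n) (fun _ _ => 0))
    (c := Sum.elim (fun _ _ => 0) (fun _ _ => 1)) (x := p)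
    ?_ ?_ ?_ ?_ (Sum.inl i)
  · rintro (i | _) (j | _)
    · simpa [formA_apply] using hD.smoothFun_gamma (hs i) (hs j)
    · simpa [formA_apply] using hD.smoothFun_ell (hs i)
    · simpa [formA_apply] using hD.smoothFun_ell (hs j)
    · simpa [formA_apply] using hell2
  · have := (LinearMap.BilinForm.nondegenerate_iff_det_ne_zero
      ((t.basisAt (Module.finBasis ℝ E) hp).prod (Module.Basis.singleton Unit ℝ))).1
      (hD.nondegenerate p)
    convert! this using 3
    funext k l
    have e (k : Fin (Module.finrank ℝ E) ⊕ Unit) :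
        Sum.elim (fun i => (frame E p i p, (0 : ℝ))) (fun _ => (0, 1)) k
          = (t.basisAt (Module.finBasis ℝ E) hp).prod (Module.Basis.singleton Unit ℝ) k := by
      rcases k with i | _
      · simp [frame, t, Bundle.Trivialization.localFrame_apply_of_mem_baseSet _ _ hp]
      · simp
    simp only [Matrix.of_apply, e, LinearMap.BilinForm.toMatrix_apply]
  · rintro (j | _)
    exacts [SmoothFun.const 0, SmoothFun.const 1]
  · filter_upwards [eventually_eq_sum_frame (E := E) p] with q hq l
    have h := hD.formA_n (p := q)
      (Sum.elim (fun i => (frame E p i q, (0 : ℝ))) (fun _ => (0, 1)) l)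
    have e : ((D.n q, 0) : TangentSpace 𝓘(ℝ, E) q × ℝ)
        = ∑ i, frameCoeff p i D.n q • (frame E p i q, (0 : ℝ)) := by
      refine Prod.ext ?_ ?_
      · simpa [Prod.fst_sum] using hq D.n
      · simp [Prod.snd_sum]
    rw [e, map_sum] at h
    simp only [map_smul, LinearMap.sum_apply, LinearMap.smul_apply, smul_eq_mul] at h
    rw [Fintype.sum_sum_type]
    simp only [Sum.elim_inl, Matrix.of_apply, h, Sum.elim_inr, zero_mul, Finset.sum_const_zero,
      add_zero]
    rcases l with j | _ <;> rfl

theorem extD_tensorial_left (hD : D.IsNull) {Y : VField E H} (_ : SmoothField Y p) :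
    IsTensorialAt (fun X => dirDeriv X (fun q => D.ell q (Y q)) p
      - dirDeriv Y (fun q => D.ell q (X q)) p - D.ell p (mlieBracket 𝓘(ℝ, E) X Y p)) p where
  smul {f X} hf hX := by
    have h := hD.smoothFun_ell hX
    simp only [Pi.smul_apply', map_smul, smul_eq_mul, dirDeriv_smul_field, dirDeriv_mul hf h,
      bracket_smul_left hf hX, map_add]
    ring
  add {X X'} hX hX' := by
    simp only [Pi.add_apply, map_add, dirDeriv_add_field, bracket_add_left hX hX',
      dirDeriv_add (hD.smoothFun_ell hX) (hD.smoothFun_ell hX')]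
    ring

theorem F_smul_left (hD : D.IsNull) (c : ℝ) (v w : TangentSpace 𝓘(ℝ, E) p) :
    D.F p (c • v) w = c * D.F p v w := by
  have h := (hD.extD_tensorial_left (SmoothField.ext w)).ext_smul c v
  simp only [F, extD, smul_eq_mul] at h ⊢
  rw [h]
  ring

end IsNull

/-- The data `D'` is obtained from `D` by multiplying the rigging with `ζ`. -/
structure IsRescaling (D D' : MetricData E H) (ζ : H → ℝ) : Prop where
  gamma : D'.gamma = D.gamma
  ell : ∀ p v, D'.ell p v = ζ p * D.ell p v
  ell2 : ∀ p, D'.ell2 p = ζ p ^ 2 * D.ell2 p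
  ne_zero : ∀ p, ζ p ≠ 0
  smooth : ∀ p, SmoothFun E ζ p

namespace IsRescaling

variable (h : IsRescaling D D' ζ)
include h

-- Rescaling the rigging amounts to the substitution `a ↦ ζ a` in the factor `ℝ`. Nondegeneracy and
-- the transformation of `n` and `P` are read off from this.
omit [IsManifold 𝓘(ℝ, E) ∞ H] in
theorem formA (x y : TangentSpace 𝓘(ℝ, E) p × ℝ) :
    D'.formA p x y = D.formA p (x.1, ζ p * x.2) (y.1, ζ p * y.2) := by
  simp only [formA_apply, h.gamma, h.ell, h.ell2]
  ring

omit [IsManifold 𝓘(ℝ, E) ∞ H] in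
theorem nondegenerate (hD : (D.formA p).Nondegenerate) : (D'.formA p).Nondegenerate := by
  have h0 := h.ne_zero p
  have key (x : TangentSpace 𝓘(ℝ, E) p × ℝ) (hx : (x.1, ζ p * x.2) = 0) : x = 0 := by
    obtain ⟨h1, h2⟩ := Prod.mk_eq_zero.1 hx
    exact Prod.ext h1 (by simpa [h0] using h2)
  refine ⟨fun x hx => key x (hD.1 _ fun y => ?_), fun x hx => key x (hD.2 _ fun y => ?_)⟩
  · have := hx (y.1, (ζ p)⁻¹ * y.2)
    rwa [h.formA, mul_inv_cancel_left₀ h0] at this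
  · have := hx (y.1, (ζ p)⁻¹ * y.2)
    rwa [h.formA, mul_inv_cancel_left₀ h0] at this

variable [FiniteDimensional ℝ E] (hD : D.IsNull)
include hD

theorem n_eq : D'.n = (fun p => (ζ p)⁻¹) • D.n := by
  funext p
  have h0 := h.ne_zero p
  have : raise (D'.formA p) (LinearMap.snd ℝ (TangentSpace 𝓘(ℝ, E) p) ℝ)
      = ((ζ p)⁻¹ • D.n p, 0) := by
    refine raise_eq (h.nondegenerate (hD.nondegenerate p)) fun v => ?_
    have e : (((ζ p)⁻¹ • D.n p, ζ p * 0) : TangentSpace 𝓘(ℝ, E) p × ℝ)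
        = (ζ p)⁻¹ • (D.n p, 0) := by simp
    rw [h.formA]
    simp only [e, map_smul, LinearMap.smul_apply, hD.formA_n]
    simp [h0]
  simp only [n, this, Pi.smul_apply']

theorem Psharp_eq (α : Module.Dual ℝ (TangentSpace 𝓘(ℝ, E) p)) : D'.Psharp p α = D.Psharp p α := by
  set u := raise (D.formA p) (α ∘ₗ LinearMap.fst ℝ (TangentSpace 𝓘(ℝ, E) p) ℝ) with hu
  have : raise (D'.formA p) (α ∘ₗ LinearMap.fst ℝ (TangentSpace 𝓘(ℝ, E) p) ℝ)
      = (u.1, (ζ p)⁻¹ * u.2) := by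
    refine raise_eq (h.nondegenerate (hD.nondegenerate p)) fun v => ?_
    rw [h.formA, mul_inv_cancel_left₀ (h.ne_zero p)]
    exact raise_spec (hD.nondegenerate p) _ (v.1, ζ p * v.2)
  rw [Psharp, this, Psharp]

theorem P_eq : D'.P p = D.P p := by
  funext α β
  rw [P, P, h.Psharp_eq hD]

/-- The terms with the differential of `ζ⁻¹` are multiplied by `γ(n, ·) = 0`. -/
theorem U_eq (v w : TangentSpace 𝓘(ℝ, E) p) : D'.U p v w = (ζ p)⁻¹ * D.U p v w := by
  have e : D'.gammaCov = D.gammaCov := by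
    funext q v w; simp only [MetricData.gammaCov, h.gamma]
  rw [U, U, e, h.n_eq hD, hD.isSmoothTensorOn_gammaCov.lieD_smul_field (Set.mem_univ p)
    ((h.smooth p).inv (h.ne_zero p)) hD.smoothField_n]
  simp only [gammaCov, hD.gamma_n, hD.symm p v, mul_zero, add_zero]
  ring

theorem F_eq (v w : TangentSpace 𝓘(ℝ, E) p) :
    D'.F p v w = ζ p * D.F p v w + (1 / 2) * (mvfderiv 𝓘(ℝ, E) ζ p v * D.ell p w
      - mvfderiv 𝓘(ℝ, E) ζ p w * D.ell p v) := by
  have hζ := h.smooth p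
  simp only [F, extD, h.ell, dirDeriv_mul hζ (hD.smoothFun_ell (SmoothField.ext v)),
    dirDeriv_mul hζ (hD.smoothFun_ell (SmoothField.ext w)), dirDeriv_eq_mvfderiv _ ζ, ext_self]
  ring

theorem s_eq (v : TangentSpace 𝓘(ℝ, E) p) :
    D'.s p v = D.s p v + (1 / 2) * (ζ p)⁻¹ * (mvfderiv 𝓘(ℝ, E) ζ p (D.n p) * D.ell p v
      - mvfderiv 𝓘(ℝ, E) ζ p v) := by
  have h0 := h.ne_zero p
  rw [s, s, h.F_eq hD, h.n_eq hD, Pi.smul_apply', hD.F_smul_left, map_smul, map_smul, hD.ell_n]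
  simp only [smul_eq_mul]
  field_simp

/-- The Koszul part involves only `γ` and `P`, which do not change; the whole difference sits in the
coefficient of `n`, through `ℓ` and `F`. -/
theorem nablaO_eq (hY : SmoothField Y p) :
    D'.nablaO X Y p = D.nablaO X Y p + ((1 / 2) * (ζ p)⁻¹
      * (mvfderiv 𝓘(ℝ, E) ζ p (X p) * D.ell p (Y p)
        + mvfderiv 𝓘(ℝ, E) ζ p (Y p) * D.ell p (X p))) • D.n p := by
  have h0 := h.ne_zero p
  have e : D'.gammaCov = D.gammaCov := by
    funext q v w; simp only [MetricData.gammaCov, h.gamma]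
  simp only [nablaO, e, h.Psharp_eq hD, h.ell, dirDeriv_mul (h.smooth p) (hD.smoothFun_ell hY),
    h.F_eq hD, h.n_eq hD, Pi.smul_apply', smul_smul, add_assoc, ← add_smul,
    dirDeriv_eq_mvfderiv _ ζ]
  congr 2
  field_simp
  ring

theorem nablaOForm_eq {θ : Cov1 E H} (hadd : ∀ v w, θ p (v + w) = θ p v + θ p w)
    (hsmul : ∀ (c : ℝ) v, θ p (c • v) = c * θ p v)
    (hθ : ∀ Y : VField E H, SmoothField Y p → SmoothFun E (fun q => θ q (Y q)) p)
    (k : ℕ) (v w : TangentSpace 𝓘(ℝ, E) p) :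
    D'.nablaOForm (fun q u => ζ q ^ k * θ q u) p v w
      = ζ p ^ k * D.nablaOForm θ p v w
        + k * ζ p ^ (k - 1) * mvfderiv 𝓘(ℝ, E) ζ p v * θ p w
        - ζ p ^ k * ((1 / 2) * (ζ p)⁻¹ * (mvfderiv 𝓘(ℝ, E) ζ p v * D.ell p w
          + mvfderiv 𝓘(ℝ, E) ζ p w * D.ell p v)) * θ p (D.n p) := by
  have hw := SmoothField.ext w
  simp only [nablaOForm, dirDeriv_mul ((h.smooth p).pow k) (hθ _ hw),
    h.nablaO_eq hD hw, hadd, hsmul, ext_self]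
  rw [dirDeriv_eq_mvfderiv _ (fun q => ζ q ^ k), mvfderiv_pow_apply (h.smooth p), ext_self]
  ring

end IsRescaling

end MetricData

end Rescaling

/-! ### Lie derivatives of the metric along a geodesic field. -/

section Geodesic

variable {F : Type*} [NormedAddCommGroup F] [NormedSpace ℝ F]
  {M : Type*} [TopologicalSpace M] [ChartedSpace F M] [IsManifold 𝓘(ℝ, F) ∞ M]
  (g : SemiRiemannianMetric F M) {W : Set M} {ξ : VField F M} {x : M}

local notation "⁅" X ", " Y "⁆ₘ" => mlieBracket 𝓘(ℝ, F) X Y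

namespace SemiRiemannianMetric

theorem isSmoothTensorOn_toCov2 (hW : IsOpen W) : IsSmoothTensorOn g.toCov2 W where
  isOpen := hW
  add_left _ _ v v' w := g.toCov2_add_left v v' w
  smul_left _ _ c v w := g.toCov2_smul_left c v w
  add_right _ _ v w w' := g.toCov2_add_right v w w'
  smul_right _ _ c v w := g.toCov2_smul_right c v w
  smooth _ _ _ _ hX hY := g.smoothFun_toCov2 hX hY

variable [FiniteDimensional ℝ F]

theorem isSmoothTensorOn_ricci (hW : IsOpen W) : IsSmoothTensorOn g.ricci W := by
  have hadd (x : M) (v v' w : TangentSpace 𝓘(ℝ, F) x) :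
      g.ricci x (v + v') w = g.ricci x v w + g.ricci x v' w := by
    simpa using (g.ricci_tensorial_left (SmoothField.ext w)).ext_add v v'
  have hsmul (x : M) (c : ℝ) (v w : TangentSpace 𝓘(ℝ, F) x) :
      g.ricci x (c • v) w = c * g.ricci x v w := by
    simpa using (g.ricci_tensorial_left (SmoothField.ext w)).ext_smul c v
  exact
    { isOpen := hW
      add_left := fun x _ => hadd x
      smul_left := fun x _ => hsmul x
      add_right := fun x _ v w w' => by
        rw [g.ricci_symm, hadd, g.ricci_symm w, g.ricci_symm w']
      smul_right := fun x _ c v w => by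
        rw [g.ricci_symm, hsmul, g.ricci_symm w]
      smooth := fun x _ X Y hX hY => g.smoothFun_ricci hX hY }

/-- For a geodesic field `ξ`, `(L_ξ g)(ξ, ·) = ½ d(g(ξ, ξ))`. -/
theorem lieD_geodesic_left (hξ : SmoothField ξ x) (hgeod : g.nabla ξ ξ x = 0)
    (v : TangentSpace 𝓘(ℝ, F) x) :
    lieD ξ g.toCov2 x (ξ x) v
      = (1 / 2) * mvfderiv 𝓘(ℝ, F) (fun y => g.toCov2 y (ξ y) (ξ y)) x v := by
  have hv := SmoothField.ext v
  have h1 := (g.isSmoothTensorOn_toCov2 isOpen_univ).lieD_self_left (Set.mem_univ x) hξ hv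
  have h2 := g.toCov2_nabla hξ hξ hv
  have h0 : g.toCov2 x 0 (ext v x) = 0 :=
    (g.isSmoothTensorOn_toCov2 isOpen_univ).zero_left (Set.mem_univ x) _
  have h00 : g.toCov2 x 0 v = 0 :=
    (g.isSmoothTensorOn_toCov2 isOpen_univ).zero_left (Set.mem_univ x) _
  rw [hgeod, h0, koszul, mlieBracket_self, Pi.zero_apply, g.toCov2_symm (⁅ξ, ext v⁆ₘ x)] at h2
  rw [ext_self] at h1 h2
  rw [dirDeriv_eq_mvfderiv (ext v), ext_self, h00] at h2
  rw [h1]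
  linarith

/-- `(L_ξ g)(ξ, ξ)` equals `ξ(g(ξ, ξ))` and also half of it. -/
theorem dirDeriv_norm_geodesic (hξ : SmoothField ξ x) (hgeod : g.nabla ξ ξ x = 0) :
    dirDeriv ξ (fun y => g.toCov2 y (ξ y) (ξ y)) x = 0 := by
  have h1 := g.lieD_geodesic_left hξ hgeod (ξ x)
  rw [(g.isSmoothTensorOn_toCov2 isOpen_univ).lieD_self_self (Set.mem_univ x) hξ,
    ← dirDeriv_eq_mvfderiv] at h1
  linarith

theorem lieD_geodesic_self (hξ : SmoothField ξ x) (hgeod : g.nabla ξ ξ x = 0) :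
    lieD ξ g.toCov2 x (ξ x) (ξ x) = 0 := by
  rw [(g.isSmoothTensorOn_toCov2 isOpen_univ).lieD_self_self (Set.mem_univ x) hξ,
    g.dirDeriv_norm_geodesic hξ hgeod]

/-- For a geodesic field `ξ`, `(L_ξ^(k) g)(ξ, ·) = 0` for `k ≥ 2`. -/
theorem iterate_lieD_geodesic_left (hW : IsOpen W) (hξ : ∀ x ∈ W, SmoothField ξ x)
    (hgeod : ∀ x ∈ W, g.nabla ξ ξ x = 0) (k : ℕ) (hx : x ∈ W) (v : TangentSpace 𝓘(ℝ, F) x) :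
    (lieD ξ)^[k + 2] g.toCov2 x (ξ x) v = 0 := by
  have hT := g.isSmoothTensorOn_toCov2 hW
  have hv := SmoothField.ext v
  induction k generalizing x with
  -- Contraction commutes with `L_ξ`, so the value is `½ L_ξ d(g(ξ, ξ))`, and `g(ξ, ξ)` is constant
  -- along `ξ`.
  | zero =>
    have hf := g.smoothFun_toCov2 (hξ x hx) (hξ x hx)
    have h1 := (hT.lieD hξ).lieD_self_left hx (hξ x hx) hv
    rw [ext_self, g.lieD_geodesic_left (hξ x hx) (hgeod x hx), dirDeriv_congr
      (h := fun y => 1 / 2 * dirDeriv (ext v) (fun y => g.toCov2 y (ξ y) (ξ y)) y)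
      ((hT.eventually_mem hx).mono fun y hy => g.lieD_geodesic_left (hξ y hy) (hgeod y hy) _),
      dirDeriv_mul (SmoothFun.const _) (hf.dirDeriv hv), dirDeriv_const,
      dirDeriv_dirDeriv_of_invariant (hξ x hx) hv hf ((hT.eventually_mem hx).mono
        fun y hy => g.dirDeriv_norm_geodesic (hξ y hy) (hgeod y hy))] at h1
    rw [zero_add, Function.iterate_succ_apply', Function.iterate_one, h1]
    ring
  | succ k ih =>
    have h1 := (hT.iterate_lieD hξ (k + 2)).lieD_self_left hx (hξ x hx) hv
    rw [ext_self, ih hx _ (SmoothField.ext _), dirDeriv_congr (h := fun _ => 0)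
      ((hT.eventually_mem hx).mono fun y hy => ih hy _ (SmoothField.ext _)), dirDeriv_const,
      sub_zero] at h1
    rw [show k + 1 + 2 = (k + 2) + 1 from rfl, Function.iterate_succ_apply', h1]

end SemiRiemannianMetric

end Geodesic

/-! ### Transformation of the transverse expansion of the metric. -/

section Embedded

variable {E : Type*} [NormedAddCommGroup E] [NormedSpace ℝ E] [FiniteDimensional ℝ E]
  {H : Type*} [TopologicalSpace H] [ChartedSpace E H] [IsManifold 𝓘(ℝ, E) ∞ H]
  {F : Type*} [NormedAddCommGroup F] [NormedSpace ℝ F] [FiniteDimensional ℝ F]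
  {M : Type*} [TopologicalSpace M] [ChartedSpace F M] [IsManifold 𝓘(ℝ, F) ∞ M]
  {g : SemiRiemannianMetric F M} {Φ : H → M} {W : Set M} {ξ : VField F M} {z : M → ℝ} {p : H}

namespace IsRigging

omit [FiniteDimensional ℝ E] [IsManifold 𝓘(ℝ, E) ∞ H] [FiniteDimensional ℝ F] in
theorem mem (hξ : IsRigging (E := E) Φ W ξ) (p : H) : Φ p ∈ W := hξ.range_subset ⟨p, rfl⟩

omit [FiniteDimensional ℝ E] [IsManifold 𝓘(ℝ, E) ∞ H] [FiniteDimensional ℝ F] in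
theorem smoothField (hξ : IsRigging (E := E) Φ W ξ) {x : M} (hx : x ∈ W) : SmoothField ξ x := by
  filter_upwards [hξ.isOpen.mem_nhds hx] with y hy
  exact hξ.smooth.contMDiffAt (hξ.isOpen.mem_nhds hy)

omit [FiniteDimensional ℝ E] [IsManifold 𝓘(ℝ, E) ∞ H] [FiniteDimensional ℝ F] in
theorem smoothFun (hξ : IsRigging (E := E) Φ W ξ) (hz : ContMDiffOn 𝓘(ℝ, F) 𝓘(ℝ, ℝ) ∞ z W)
    {x : M} (hx : x ∈ W) : SmoothFun F z x := by
  filter_upwards [hξ.isOpen.mem_nhds hx] with y hy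
  exact hz.contMDiffAt (hξ.isOpen.mem_nhds hy)

end IsRigging

/-- A rigged hypersurface with null induced data, whose rigging is geodesic and null along the
hypersurface, and a factor `z` by which the rigging is to be multiplied. -/
structure GeodesicRescaling (E : Type*) [NormedAddCommGroup E] [NormedSpace ℝ E]
    [FiniteDimensional ℝ E] {H : Type*} [TopologicalSpace H] [ChartedSpace E H]
    [IsManifold 𝓘(ℝ, E) ∞ H] (g : SemiRiemannianMetric F M) (Φ : H → M) (W : Set M)
    (ξ : VField F M) (z : M → ℝ) : Prop where
  rigging : IsRigging (E := E) Φ W ξ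
  null : (inducedData (E := E) g Φ ξ).IsNull
  geodesic : ∀ x ∈ W, g.nabla ξ ξ x = 0
  ell2 : ∀ p, (inducedData (E := E) g Φ ξ).ell2 p = 0
  smooth : ContMDiffOn 𝓘(ℝ, F) 𝓘(ℝ, ℝ) ∞ z W
  ne_zero : ∀ x ∈ W, z x ≠ 0
  dirDeriv_eq_zero : ∀ x ∈ W, dirDeriv ξ z x = 0

namespace GeodesicRescaling

variable (h : GeodesicRescaling E g Φ W ξ z)
include h

theorem smoothField {x : M} (hx : x ∈ W) : SmoothField ξ x := h.rigging.smoothField hx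

theorem smoothFun {x : M} (hx : x ∈ W) : SmoothFun F z x := h.rigging.smoothFun h.smooth hx

theorem contMDiff : ContMDiff 𝓘(ℝ, E) 𝓘(ℝ, F) ∞ Φ := h.rigging.embedding.contMDiff

theorem smoothFun_comp (p : H) : SmoothFun E (z ∘ Φ) p :=
  (h.smoothFun (h.rigging.mem p)).comp h.contMDiff

theorem mvfderiv_comp (v : TangentSpace 𝓘(ℝ, E) p) :
    mvfderiv 𝓘(ℝ, F) z (Φ p) (mfderiv 𝓘(ℝ, E) 𝓘(ℝ, F) Φ p v) = mvfderiv 𝓘(ℝ, E) (z ∘ Φ) p v :=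
  (mvfderiv_comp_smooth (h.smoothFun (h.rigging.mem p)) h.contMDiff v).symm

theorem isRescaling :
    MetricData.IsRescaling (inducedData (E := E) g Φ ξ) (inducedData g Φ (z • ξ)) (z ∘ Φ) where
  gamma := rfl
  ell p v := by simp [inducedData]
  ell2 p := by simp [inducedData]; ring
  ne_zero p := h.ne_zero _ (h.rigging.mem p)
  smooth := h.smoothFun_comp

theorem toCov2_rigging (p : H) : g.toCov2 (Φ p) (ξ (Φ p)) (ξ (Φ p)) = 0 := h.ell2 p

/-- Unlike the higher orders, this vanishes only along the hypersurface and on tangent vectors: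
`g(ξ, ξ)` is zero on `Φ(H)`, so its tangential derivatives are too. -/
theorem lieD_rigging_left (v : TangentSpace 𝓘(ℝ, E) p) :
    lieD ξ g.toCov2 (Φ p) (ξ (Φ p)) (mfderiv 𝓘(ℝ, E) 𝓘(ℝ, F) Φ p v) = 0 := by
  have hx := h.rigging.mem p
  have hs := h.smoothField hx
  rw [g.lieD_geodesic_left hs (h.geodesic _ hx),
    ← mvfderiv_comp_smooth (g.smoothFun_toCov2 hs hs) h.contMDiff,
    show (fun y => g.toCov2 y (ξ y) (ξ y)) ∘ Φ = fun _ => 0 from funext h.toCov2_rigging]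
  simp [mvfderiv_const]

theorem iterate_lieD_rigging_left (k : ℕ) (v : TangentSpace 𝓘(ℝ, E) p) :
    (lieD ξ)^[k + 1] g.toCov2 (Φ p) (ξ (Φ p)) (mfderiv 𝓘(ℝ, E) 𝓘(ℝ, F) Φ p v) = 0 := by
  rcases k with _ | k
  · exact h.lieD_rigging_left v
  · exact g.iterate_lieD_geodesic_left h.rigging.isOpen (fun _ => h.smoothField) h.geodesic k
      (h.rigging.mem p) _

theorem iterate_lieD_rigging_self (k : ℕ) :
    (lieD ξ)^[k] g.toCov2 (Φ p) (ξ (Φ p)) (ξ (Φ p)) = 0 := by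
  have hx := h.rigging.mem p
  rcases k with _ | _ | k
  · exact h.toCov2_rigging p
  · exact g.lieD_geodesic_self (h.smoothField hx) (h.geodesic _ hx)
  · exact g.iterate_lieD_geodesic_left h.rigging.isOpen (fun _ => h.smoothField) h.geodesic k hx _

theorem iterate_lieD_smul_rigging {T : Cov2 F M} (hT : IsSmoothTensorOn T W)
    (hsymm : ∀ x v w, T x v w = T x w v) (m : ℕ) (v w : TangentSpace 𝓘(ℝ, F) (Φ p)) :
    (lieD (z • ξ))^[m] T (Φ p) v w
      = z (Φ p) ^ m * (lieD ξ)^[m] T (Φ p) v w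
        + m * z (Φ p) ^ (m - 1)
          * (mvfderiv 𝓘(ℝ, F) z (Φ p) v * (lieD ξ)^[m - 1] T (Φ p) (ξ (Φ p)) w
            + mvfderiv 𝓘(ℝ, F) z (Φ p) w * (lieD ξ)^[m - 1] T (Φ p) (ξ (Φ p)) v)
        + m * (m - 1) * z (Φ p) ^ (m - 2) * (lieD ξ)^[m - 2] T (Φ p) (ξ (Φ p)) (ξ (Φ p))
          * (mvfderiv 𝓘(ℝ, F) z (Φ p) v * mvfderiv 𝓘(ℝ, F) z (Φ p) w) := by
  rw [iterate_lieD_smul hT (fun _ => h.smoothField) (fun _ => h.smoothFun) h.dirDeriv_eq_zero m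
    (h.rigging.mem p), iterate_lieD_symm hsymm _ _ v (ξ (Φ p))]

/-- From order two on, every correction contains a contraction with `ξ` that vanishes along `Φ(H)`.
At order one the contraction is of `g` itself and produces `ℓ`. -/
theorem Yexp_smul (m : ℕ) (v w : TangentSpace 𝓘(ℝ, E) p) :
    Yexp g Φ (z • ξ) (m + 2) p v w = z (Φ p) ^ (m + 2) * Yexp g Φ ξ (m + 2) p v w := by
  simp only [Yexp, pullback2]
  rw [h.iterate_lieD_smul_rigging (g.isSmoothTensorOn_toCov2 h.rigging.isOpen)
    (fun x => g.toCov2_symm)]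
  simp only [show m + 2 - 1 = m + 1 by omega, h.iterate_lieD_rigging_left,
    h.iterate_lieD_rigging_self]
  ring

theorem Yexp_one_smul (v w : TangentSpace 𝓘(ℝ, E) p) :
    Yexp g Φ (z • ξ) 1 p v w = z (Φ p) * Yexp g Φ ξ 1 p v w
      + (1 / 2) * (mvfderiv 𝓘(ℝ, E) (z ∘ Φ) p v * (inducedData (E := E) g Φ ξ).ell p w
        + mvfderiv 𝓘(ℝ, E) (z ∘ Φ) p w * (inducedData (E := E) g Φ ξ).ell p v) := by
  simp only [Yexp, pullback2]
  rw [h.iterate_lieD_smul_rigging (g.isSmoothTensorOn_toCov2 h.rigging.isOpen)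
    (fun x => g.toCov2_symm), h.mvfderiv_comp, h.mvfderiv_comp]
  have e (u : TangentSpace 𝓘(ℝ, E) p) : (inducedData (E := E) g Φ ξ).ell p u
    = g.toCov2 (Φ p) (ξ (Φ p)) (mfderiv 𝓘(ℝ, E) 𝓘(ℝ, F) Φ p u) := rfl
  simp only [e, Nat.sub_self, Function.iterate_zero, id, pow_one, pow_zero, Nat.cast_one, sub_self,
    mul_zero, zero_mul, add_zero]
  ring

end GeodesicRescaling

end Embedded

/-! ### Transformation of the part linear in the highest-order expansion tensor. -/

section LeadingPart

variable {E : Type*} [NormedAddCommGroup E] [NormedSpace ℝ E] [FiniteDimensional ℝ E]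
  {H : Type*} [TopologicalSpace H] [ChartedSpace E H] [IsManifold 𝓘(ℝ, E) ∞ H]
  {F : Type*} [NormedAddCommGroup F] [NormedSpace ℝ F] [FiniteDimensional ℝ F]
  {M : Type*} [TopologicalSpace M] [ChartedSpace F M] [IsManifold 𝓘(ℝ, F) ∞ M]
  {g : SemiRiemannianMetric F M} {Φ : H → M} {W : Set M} {ξ : VField F M} {z : M → ℝ} {p : H}

omit [FiniteDimensional ℝ E] [IsManifold 𝓘(ℝ, E) ∞ H] [FiniteDimensional ℝ F] in
theorem Yexp_symm (m : ℕ) (v w : TangentSpace 𝓘(ℝ, E) p) :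
    Yexp g Φ ξ m p v w = Yexp g Φ ξ m p w v := by
  simp only [Yexp, pullback2]
  rw [iterate_lieD_symm fun x => g.toCov2_symm]

namespace GeodesicRescaling

variable (h : GeodesicRescaling E g Φ W ξ z)
include h

theorem z_ne_zero (p : H) : z (Φ p) ≠ 0 := h.ne_zero _ (h.rigging.mem p)

theorem isSmoothTensorOn_Yexp (m : ℕ) :
    IsSmoothTensorOn (Yexp (E := E) g Φ ξ m) Set.univ :=
  (((g.isSmoothTensorOn_toCov2 h.rigging.isOpen).iterate_lieD (fun _ => h.smoothField) m).pullback2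
    h.contMDiff h.rigging.mem).mul fun _ _ => SmoothFun.const (1 / 2)

theorem n_smul : (inducedData (E := E) g Φ (z • ξ)).n
    = (fun q => ((z ∘ Φ) q)⁻¹) • (inducedData (E := E) g Φ ξ).n := h.isRescaling.n_eq h.null

theorem n_smul_apply (p : H) : (inducedData (E := E) g Φ (z • ξ)).n p
    = (z (Φ p))⁻¹ • (inducedData (E := E) g Φ ξ).n p := congrFun h.n_smul p

theorem rexp_smul (m : ℕ) (v : TangentSpace 𝓘(ℝ, E) p) :
    rexp g Φ (z • ξ) (m + 2) p v = z (Φ p) ^ (m + 1) * rexp g Φ ξ (m + 2) p v := by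
  have h0 := h.z_ne_zero p
  rw [rexp, rexp, h.Yexp_smul, h.n_smul_apply,
    (h.isSmoothTensorOn_Yexp _).smul_left p trivial]
  field_simp
  ring

theorem rexp_one_smul (v : TangentSpace 𝓘(ℝ, E) p) :
    rexp g Φ (z • ξ) 1 p v = rexp g Φ ξ 1 p v + (1 / 2) * (z (Φ p))⁻¹
      * (mvfderiv 𝓘(ℝ, E) (z ∘ Φ) p ((inducedData (E := E) g Φ ξ).n p)
          * (inducedData (E := E) g Φ ξ).ell p v + mvfderiv 𝓘(ℝ, E) (z ∘ Φ) p v) := by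
  have h0 := h.z_ne_zero p
  rw [rexp, rexp, h.Yexp_one_smul, h.n_smul_apply,
    (h.isSmoothTensorOn_Yexp _).smul_left p trivial, map_smul, map_smul, h.null.ell_n]
  simp only [smul_eq_mul]
  field_simp

theorem kexp_smul (m : ℕ) :
    kexp E g Φ (z • ξ) (m + 2) p = z (Φ p) ^ m * kexp E g Φ ξ (m + 2) p := by
  have h0 := h.z_ne_zero p
  rw [kexp, kexp, h.Yexp_smul, h.n_smul_apply,
    (h.isSmoothTensorOn_Yexp _).smul_left p trivial,
    (h.isSmoothTensorOn_Yexp _).smul_right p trivial]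
  field_simp
  ring

theorem kexp_one_smul :
    kexp E g Φ (z • ξ) 1 p = (z (Φ p))⁻¹ * kexp E g Φ ξ 1 p - ((z (Φ p))⁻¹) ^ 2
      * mvfderiv 𝓘(ℝ, E) (z ∘ Φ) p ((inducedData (E := E) g Φ ξ).n p) := by
  have h0 := h.z_ne_zero p
  rw [kexp, kexp, h.Yexp_one_smul, h.n_smul_apply,
    (h.isSmoothTensorOn_Yexp _).smul_left p trivial,
    (h.isSmoothTensorOn_Yexp _).smul_right p trivial, map_smul, map_smul, h.null.ell_n]
  simp only [smul_eq_mul]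
  field_simp
  ring

theorem trY_smul (m : ℕ) :
    trY E g Φ (z • ξ) (m + 2) p = z (Φ p) ^ (m + 2) * trY E g Φ ξ (m + 2) p := by
  rw [trY, trY, MetricData.trP, MetricData.trP, h.isRescaling.P_eq h.null, ← contract_mul]
  congr 1
  funext v w
  exact h.Yexp_smul m v w

theorem trP_U_smul :
    (inducedData (E := E) g Φ (z • ξ)).trP (inducedData (E := E) g Φ (z • ξ)).U p
      = (z (Φ p))⁻¹
        * (inducedData (E := E) g Φ ξ).trP (inducedData (E := E) g Φ ξ).U p := by
  rw [MetricData.trP, MetricData.trP, h.isRescaling.P_eq h.null, ← contract_mul]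
  congr 1
  funext v w
  exact h.isRescaling.U_eq h.null v w

/-- Here `z^(m+2) Y` is differentiated along `z⁻¹ n`: the weight yields the `dz(n)` term, and the
differential of `z⁻¹`, paired with `Y(n, ·)`, yields the terms in `r`. -/
theorem lieD_n_smul (m : ℕ) (v w : TangentSpace 𝓘(ℝ, E) p) :
    lieD (inducedData (E := E) g Φ (z • ξ)).n (Yexp g Φ (z • ξ) (m + 2)) p v w
      = z (Φ p) ^ (m + 1) * lieD (inducedData (E := E) g Φ ξ).n (Yexp g Φ ξ (m + 2)) p v w
        + (m + 2) * z (Φ p) ^ m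
          * mvfderiv 𝓘(ℝ, E) (z ∘ Φ) p ((inducedData (E := E) g Φ ξ).n p)
          * Yexp g Φ ξ (m + 2) p v w
        - z (Φ p) ^ m * (mvfderiv 𝓘(ℝ, E) (z ∘ Φ) p v * rexp g Φ ξ (m + 2) p w
          + mvfderiv 𝓘(ℝ, E) (z ∘ Φ) p w * rexp g Φ ξ (m + 2) p v) := by
  have h0 := h.z_ne_zero p
  have hζ := h.smoothFun_comp
  have hY := h.isSmoothTensorOn_Yexp (m + 2)
  have e : Yexp (E := E) g Φ (z • ξ) (m + 2)
      = fun q v w => (z ∘ Φ) q ^ (m + 2) * Yexp g Φ ξ (m + 2) q v w :=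
    funext fun q => funext₂ fun v w => h.Yexp_smul m v w
  rw [e, h.n_smul, (hY.mul fun q _ => (hζ q).pow (m + 2)).lieD_smul_field (Set.mem_univ p)
    ((hζ p).inv h0) h.null.smoothField_n, hY.lieD_mul (Set.mem_univ p) ((hζ p).pow _),
    dirDeriv_eq_mvfderiv, mvfderiv_pow_apply (hζ p),
    mvfderiv_inv_apply (hζ p) h0, mvfderiv_inv_apply (hζ p) h0,
    Yexp_symm _ v ((inducedData (E := E) g Φ ξ).n p)]
  simp only [rexp, Function.comp_apply, show m + 2 - 1 = m + 1 by omega, pow_succ]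
  push_cast
  field_simp
  ring

theorem contract_smul (m : ℕ) (v w : TangentSpace 𝓘(ℝ, E) p) :
    contract ((inducedData (E := E) g Φ (z • ξ)).P p) (fun x y => (1 / 2)
        * ((inducedData (E := E) g Φ (z • ξ)).U p x v * Yexp g Φ (z • ξ) (m + 2) p w y
          + (inducedData (E := E) g Φ (z • ξ)).U p x w * Yexp g Φ (z • ξ) (m + 2) p v y))
      = z (Φ p) ^ (m + 1) * contract ((inducedData (E := E) g Φ ξ).P p) (fun x y => (1 / 2)
        * ((inducedData (E := E) g Φ ξ).U p x v * Yexp g Φ ξ (m + 2) p w y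
          + (inducedData (E := E) g Φ ξ).U p x w * Yexp g Φ ξ (m + 2) p v y)) := by
  have h0 := h.z_ne_zero p
  rw [h.isRescaling.P_eq h.null, ← contract_mul]
  congr 1
  funext x y
  simp only [h.isRescaling.U_eq h.null, h.Yexp_smul, Function.comp_apply, pow_succ]
  field_simp

theorem nablaOForm_smul (m : ℕ) (v w : TangentSpace 𝓘(ℝ, E) p) :
    (inducedData (E := E) g Φ (z • ξ)).nablaOForm (rexp g Φ (z • ξ) (m + 2)) p v w
      = z (Φ p) ^ (m + 1)
          * (inducedData (E := E) g Φ ξ).nablaOForm (rexp g Φ ξ (m + 2)) p v w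
        + (m + 1) * z (Φ p) ^ m * mvfderiv 𝓘(ℝ, E) (z ∘ Φ) p v * rexp g Φ ξ (m + 2) p w
        + z (Φ p) ^ m * (1 / 2)
          * (mvfderiv 𝓘(ℝ, E) (z ∘ Φ) p v * (inducedData (E := E) g Φ ξ).ell p w
          + mvfderiv 𝓘(ℝ, E) (z ∘ Φ) p w * (inducedData (E := E) g Φ ξ).ell p v)
          * kexp E g Φ ξ (m + 2) p := by
  have h0 := h.z_ne_zero p
  have hY := h.isSmoothTensorOn_Yexp (m + 2)
  have e : rexp (E := E) g Φ (z • ξ) (m + 2)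
      = fun q v => (z ∘ Φ) q ^ (m + 1) * rexp g Φ ξ (m + 2) q v :=
    funext fun q => funext fun v => h.rexp_smul m v
  rw [e, h.isRescaling.nablaOForm_eq h.null (θ := rexp g Φ ξ (m + 2))
    (fun v w => hY.add_right p trivial _ v w) (fun c v => hY.smul_right p trivial c _ v)
    (fun X hX => hY.smooth p trivial _ X h.null.smoothField_n hX)]
  simp only [Function.comp_apply, Nat.add_sub_cancel, rexp, kexp, pow_succ]
  push_cast
  field_simp
  ring

/-- Three cancellations: the `dz(n)` term of `L_n Y` against the shift of `κ_n`; the `dz`-`r` terms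
of `L_n Y` against `s - r`, which changes by `-z⁻¹ dz`; the `dz`-`ℓ` terms of `∇° r` against those
of `Y^(1)`. What remains comes from differentiating the weight `z^(m+1)` of `r` in `∇° r`. -/
theorem leadingPart_smul (m : ℕ) (v w : TangentSpace 𝓘(ℝ, E) p) :
    leadingPart g Φ (z • ξ) (m + 1) p v w
      = z (Φ p) ^ (m + 1) * leadingPart g Φ ξ (m + 1) p v w
        + (m + 1) * z (Φ p) ^ m
          * (mvfderiv 𝓘(ℝ, E) (z ∘ Φ) p v * rexp g Φ ξ (m + 2) p w
            + mvfderiv 𝓘(ℝ, E) (z ∘ Φ) p w * rexp g Φ ξ (m + 2) p v) := by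
  have h0 := h.z_ne_zero p
  simp only [leadingPart, show m + 1 + 1 = m + 2 from rfl, h.contract_smul]
  simp only [h.lieD_n_smul,
    h.nablaOForm_smul, h.kexp_one_smul, h.kexp_smul, h.trP_U_smul, h.trY_smul, h.Yexp_smul,
    h.Yexp_one_smul, h.rexp_smul, h.rexp_one_smul, h.isRescaling.s_eq h.null,
    h.isRescaling.U_eq h.null, Function.comp_apply, pow_succ]
  push_cast
  field_simp
  ring

end GeodesicRescaling

end LeadingPart

/-! ### Transformation of the Ricci derivatives and conclusion. -/

section Ricci

variable {E : Type*} [NormedAddCommGroup E] [NormedSpace ℝ E] [FiniteDimensional ℝ E]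
  {H : Type*} [TopologicalSpace H] [ChartedSpace E H] [IsManifold 𝓘(ℝ, E) ∞ H]
  {F : Type*} [NormedAddCommGroup F] [NormedSpace ℝ F] [FiniteDimensional ℝ F]
  {M : Type*} [TopologicalSpace M] [ChartedSpace F M] [IsManifold 𝓘(ℝ, F) ∞ M]
  {g : SemiRiemannianMetric F M} {Φ : H → M} {W : Set M} {ξ : VField F M} {z : M → ℝ} {p : H}

namespace GeodesicRescaling

variable (h : GeodesicRescaling E g Φ W ξ z)
include h

/-- Every correction contains `dz(ξ) = 0`; the two slots filled by `z ξ` account for the extra `z²`.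
-/
theorem Ric2_smul (m : ℕ) :
    Ric2 g Φ (z • ξ) (m + 1) p = z (Φ p) ^ (m + 2) * Ric2 g Φ ξ (m + 1) p := by
  have hT := g.isSmoothTensorOn_ricci h.rigging.isOpen
  have hx := h.rigging.mem p
  have hX := (hT.iterate_lieD
    (fun x hx => SmoothField.smul (h.smoothFun hx) (h.smoothField hx)) m)
  have hz : mvfderiv 𝓘(ℝ, F) z (Φ p) (ξ (Φ p)) = 0 := h.dirDeriv_eq_zero _ hx
  simp only [Ric2, Nat.add_sub_cancel, Pi.smul_apply']
  rw [hX.smul_left _ hx, hX.smul_right _ hx,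
    h.iterate_lieD_smul_rigging hT (fun x => g.ricci_symm), hz]
  ring

/-- With one slot filled by `ξ`, the only correction free of `dz(ξ)` is the one pairing `dz(v)` with
two contractions. -/
theorem Ric1_smul (m : ℕ) (v : TangentSpace 𝓘(ℝ, E) p) :
    Ric1 g Φ (z • ξ) (m + 1) p v = z (Φ p) ^ (m + 1) * Ric1 g Φ ξ (m + 1) p v
      + m * z (Φ p) ^ m * mvfderiv 𝓘(ℝ, E) (z ∘ Φ) p v * Ric2 g Φ ξ m p := by
  have hT := g.isSmoothTensorOn_ricci h.rigging.isOpen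
  have hx := h.rigging.mem p
  have hX := (hT.iterate_lieD
    (fun x hx => SmoothField.smul (h.smoothFun hx) (h.smoothField hx)) m)
  have hz : mvfderiv 𝓘(ℝ, F) z (Φ p) (ξ (Φ p)) = 0 := h.dirDeriv_eq_zero _ hx
  simp only [Ric2, Ric1, Nat.add_sub_cancel, Pi.smul_apply']
  rw [hX.smul_left _ hx, h.iterate_lieD_smul_rigging hT (fun x => g.ricci_symm), hz,
    h.mvfderiv_comp]
  -- At `m = 0` the factor `m` removes the conventional value of `Ric2` at order zero; otherwise `z
  -- · z^(m-1) = z^m`.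
  rcases m with _ | m
  · simp
  · simp only [Nat.add_sub_cancel, pow_succ]
    ring

theorem Ric0_smul (m : ℕ) (v w : TangentSpace 𝓘(ℝ, E) p) :
    Ric0 g Φ (z • ξ) (m + 1) p v w = z (Φ p) ^ m * Ric0 g Φ ξ (m + 1) p v w
      + m * z (Φ p) ^ (m - 1) * (mvfderiv 𝓘(ℝ, E) (z ∘ Φ) p v * Ric1 g Φ ξ m p w
        + mvfderiv 𝓘(ℝ, E) (z ∘ Φ) p w * Ric1 g Φ ξ m p v)
      + m * (m - 1) * z (Φ p) ^ (m - 2) * Ric2 g Φ ξ (m - 1) p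
        * (mvfderiv 𝓘(ℝ, E) (z ∘ Φ) p v * mvfderiv 𝓘(ℝ, E) (z ∘ Φ) p w) := by
  have hT := g.isSmoothTensorOn_ricci h.rigging.isOpen
  simp only [Ric0, Ric2, Ric1, pullback2, Nat.add_sub_cancel, Nat.sub_sub, Nat.reduceAdd]
  rw [h.iterate_lieD_smul_rigging hT (fun x => g.ricci_symm), h.mvfderiv_comp, h.mvfderiv_comp]

theorem Oscalar_smul (m : ℕ) :
    Oscalar E g Φ (z • ξ) (m + 1) p = z (Φ p) ^ (m + 2) * Oscalar E g Φ ξ (m + 1) p := by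
  rw [Oscalar, Oscalar, h.Ric2_smul, h.trY_smul, mul_add]

/-- `r` scales without correction, so the extra term is that of `Ric1_smul`, with `R̈^(m)` rewritten
through the scalar `O^(m)`. -/
theorem Oform_smul (m : ℕ) (v : TangentSpace 𝓘(ℝ, E) p) :
    Oform g Φ (z • ξ) (m + 1) p v = z (Φ p) ^ (m + 1) * Oform g Φ ξ (m + 1) p v
      - m * z (Φ p) ^ m * (trY E g Φ ξ (m + 1) p - Oscalar E g Φ ξ m p)
        * mvfderiv 𝓘(ℝ, E) (z ∘ Φ) p v := by
  rw [Oform, Oform, Oscalar, h.Ric1_smul, h.rexp_smul]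
  ring

/-- The `dz`-`Ṙ` terms of the Ricci side and the `dz`-`r` terms of the leading part have the same
coefficient, so their difference assembles into the one-form `O`. -/
theorem Otensor_smul (m : ℕ) (v w : TangentSpace 𝓘(ℝ, E) p) :
    Otensor g Φ (z • ξ) (m + 1) p v w = z (Φ p) ^ (m + 1) * Otensor g Φ ξ (m + 1) p v w
      + (m + 1) * z (Φ p) ^ m * (Oform g Φ ξ (m + 1) p v * mvfderiv 𝓘(ℝ, E) (z ∘ Φ) p w
        + Oform g Φ ξ (m + 1) p w * mvfderiv 𝓘(ℝ, E) (z ∘ Φ) p v)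
      - (m + 1) * m * z (Φ p) ^ (m - 1) * (trY E g Φ ξ (m + 1) p - Oscalar E g Φ ξ m p)
        * mvfderiv 𝓘(ℝ, E) (z ∘ Φ) p v * mvfderiv 𝓘(ℝ, E) (z ∘ Φ) p w := by
  rw [Otensor, Otensor, Oform, Oform, Oscalar, h.Ric0_smul, h.leadingPart_smul]
  simp only [Nat.add_sub_cancel, show m + 1 - 2 = m - 1 by omega]
  push_cast
  ring

end GeodesicRescaling

end Ricci

end HypersurfaceData

end

theorem mainTheorem7
    {E : Type*} [NormedAddCommGroup E] [NormedSpace ℝ E] [FiniteDimensional ℝ E]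
    {H : Type*} [TopologicalSpace H] [ChartedSpace E H] [IsManifold 𝓘(ℝ, E) ∞ H]
    [T2Space H] [SecondCountableTopology H] [ConnectedSpace H]
    {F : Type*} [NormedAddCommGroup F] [NormedSpace ℝ F] [FiniteDimensional ℝ F]
    {M : Type*} [TopologicalSpace M] [ChartedSpace F M] [IsManifold 𝓘(ℝ, F) ∞ M]
    [T2Space M] [SecondCountableTopology M] [ConnectedSpace M]
    (g : SemiRiemannianMetric F M) (Φ : H → M) (W : Set M) (ξ : VField F M)
    (hξ : IsRigging (E := E) Φ W ξ)
    (hnull : (inducedData (E := E) g Φ ξ).IsNull)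
    (hgeod : ∀ x ∈ W, g.nabla ξ ξ x = 0)
    (hell2 : ∀ p, (inducedData (E := E) g Φ ξ).ell2 p = 0)
    (z : M → ℝ) (hz : ContMDiffOn 𝓘(ℝ, F) 𝓘(ℝ, ℝ) ∞ z W)
    (hz0 : ∀ x ∈ W, z x ≠ 0)
    (hξz : ∀ x ∈ W, dirDeriv ξ z x = 0)
    (ξ' : VField F M) (hξ' : ∀ x, ξ' x = z x • ξ x)
    (m : ℕ) (hm : 1 ≤ m) (p : H) :
    (Oscalar E g Φ ξ' m p = z (Φ p) ^ (m + 1) * Oscalar E g Φ ξ m p) ∧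
    (∀ v : TangentSpace 𝓘(ℝ, E) p,
      Oform g Φ ξ' m p v
        = z (Φ p) ^ m * Oform g Φ ξ m p v
          - ((m : ℝ) - 1) * z (Φ p) ^ (m - 1)
            * (trY E g Φ ξ m p - Oscalar E g Φ ξ (m - 1) p)
            * mvfderiv 𝓘(ℝ, E) (z ∘ Φ) p v) ∧
    (∀ v w : TangentSpace 𝓘(ℝ, E) p,
      Otensor g Φ ξ' m p v w
        = z (Φ p) ^ m * Otensor g Φ ξ m p v w
          + 2 * (m : ℝ) * z (Φ p) ^ (m - 1)
            * ((1 / 2) * (Oform g Φ ξ m p v * mvfderiv 𝓘(ℝ, E) (z ∘ Φ) p w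
                + Oform g Φ ξ m p w * mvfderiv 𝓘(ℝ, E) (z ∘ Φ) p v))
          - (m : ℝ) * ((m : ℝ) - 1) * z (Φ p) ^ (m - 2)
            * (trY E g Φ ξ m p - Oscalar E g Φ ξ (m - 1) p)
            * mvfderiv 𝓘(ℝ, E) (z ∘ Φ) p v * mvfderiv 𝓘(ℝ, E) (z ∘ Φ) p w) := by
  obtain rfl : ξ' = z • ξ := funext hξ'
  have h : GeodesicRescaling E g Φ W ξ z := ⟨hξ, hnull, hgeod, hell2, hz, hz0, hξz⟩
  -- With `m = k + 1` the factor `m - 1` becomes `k`, which discards the meaningless scalar of order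
  -- zero when `m = 1`.
  obtain ⟨k, rfl⟩ := Nat.exists_eq_add_of_le' hm
  refine ⟨h.Oscalar_smul k, fun v => ?_, fun v w => ?_⟩
  · rw [h.Oform_smul]
    simp
  · rw [h.Otensor_smul]
    simp only [Nat.add_sub_cancel, show k + 1 - 2 = k - 1 by omega]
    push_cast
    ring
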